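/- **Discrete Colonel Blotto.** An instance consists of integers $n,m,k\ge 0$ (the numbers of troops of player 1, of troops of player 2, and of battlefields) and positive integer weights $w_1,\dots,w_k$. A pure strategy of player 1 (resp. player 2) is a vector $x\in\mathbb{Z}_{\ge0}^k$ with $\sum_i x_i\le n$ (resp. $y\in\mathbb{Z}_{\ge0}^k$ with $\sum_i y_i\le m$), and player 1 receives the utility $\mathsf u(x,y)=\sum_{i:\,x_i>y_i}w_i$. For real $u$ and $p \in [0,1]$, a (possibly mixed) strategy $X$ of player 1 is *$(u,p)$-maxmin* if $\Pr_{x\sim X,\,y\sim Y}[\mathsf u(x,y)\ge u]\ge p$ for every (possibly mixed) strategy $Y$ of player 2, where $x$ and $y$ are drawn independently. **Theorem.** For every constant $\varepsilon>0$ there is a polynomial time algorithm which, given an instance $(n,m,w_1,\dots,w_k)$ and a rational $u\ge 0$ such that player 1 has a $(u,1)$-maxmin pure strategy, outputs a $((1-\varepsilon)u,1)$-maxmin pure strategy of player 1. Here an algorithm is a program of a deterministic random access machine that holds natural numbers and charges one unit for each memory access, zero test, addition and (truncated) subtraction, and one plus the total bit length of the operands for each multiplication and integer division. Polynomial time means that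 there is a polynomial $q$, depending only on $\varepsilon$, such that on every input (also when no $(u,1)$-maxmin pure strategy exists) the program halts within time $q(N)$, where $N$ is the length of the input with $n$ and $m$ counted in unary and the weights and the numerator and denominator of $u$ counted in binary. -/

import Mathlib

open scoped ENNReal

/-! ### Maxmin strategies of two-player games -/

/-- In a game with pure strategy sets `S₁`, `S₂` and payoff `v` for player 1, the mixed strategy `X`
of player 1 is `(u, p)`-maxmin: against every mixed strategy `Y` of player 2 (the players randomize
independently) the payoff is at least `u` with probability at least `p`. -/
def IsMaxmin {S₁ S₂ : Type} (v : S₁ → S₂ → ℝ) (u : ℝ) (p : ℝ≥0∞) (X : PMF S₁) : Prop :=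
  ∀ Y : PMF S₂, p ≤ (X.bind fun x => Y.map fun y => v x y).toOuterMeasure (Set.Ici u)

/-! ### The discrete Colonel Blotto game -/

/-- An instance: `n` troops for player 1, `m` troops for player 2, and `k` battlefields with
positive integer weights `w`. -/
structure Blotto where
  k : ℕ
  n : ℕ
  m : ℕ
  w : Fin k → ℕ
  w_pos : ∀ i, 0 < w i

namespace Blotto

/-- Discrete pure strategies with a budget of `b` troops. -/
abbrev Pure (G : Blotto) (b : ℕ) : Type := {x : Fin G.k → ℕ // ∑ i, x i ≤ b}

/-- Payoff of player 1: the total weight of the battlefields where he has strictly more troops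
(ties are won by player 2). -/
def payoff (G : Blotto) (x : G.Pure G.n) (y : G.Pure G.m) : ℝ :=
  ((∑ i with y.1 i < x.1 i, G.w i : ℕ) : ℝ)

/-- The pure strategy `x` of player 1, played with probability one, is `(u, 1)`-maxmin. -/
def IsPureMaxmin (G : Blotto) (u : ℝ) (x : G.Pure G.n) : Prop :=
  IsMaxmin G.payoff u 1 (PMF.pure x)

end Blotto

/-! ### A random access machine with a structured programming language and running times

The memory has registers and arrays, all indexed by natural numbers and holding natural numbers.
Reading a cell, writing a cell, testing for zero, adding and subtracting cost one unit each.
Multiplying or dividing `a` and `b` costs one more than the total bit length of `a` and `b`, so that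
the bit length of a value exceeds those of the input by at most the time spent (up to a constant
depending on the program); hence polynomial time is the same as on Turing machines. -/

namespace RAM

structure State where
  reg : ℕ → ℕ
  arr : ℕ → ℕ → ℕ

inductive BinOp where
  | add | sub | mul | div

/-- Subtraction is truncated at zero, division rounds down (and division by zero gives zero). -/
def BinOp.eval : BinOp → ℕ → ℕ → ℕ
  | .add, a, b => a + b
  | .sub, a, b => a - b
  | .mul, a, b => a * b
  | .div, a, b => a / b

/-- `Nat.size` is the binary length. -/
def BinOp.cost : BinOp → ℕ → ℕ → ℕ
  | .add, _, _ => 1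
  | .sub, _, _ => 1
  | .mul, a, b => 1 + a.size + b.size
  | .div, a, b => 1 + a.size + b.size

/-- Expressions: constants, registers, array cells `a[e]`, and arithmetic. -/
inductive Expr where
  | const (c : ℕ)
  | reg (r : ℕ)
  | load (a : ℕ) (e : Expr)
  | bin (o : BinOp) (e₁ e₂ : Expr)

def Expr.eval (s : State) : Expr → ℕ
  | .const c => c
  | .reg r => s.reg r
  | .load a e => s.arr a (e.eval s)
  | .bin o e₁ e₂ => o.eval (e₁.eval s) (e₂.eval s)

def Expr.cost (s : State) : Expr → ℕ
  | .const _ => 1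
  | .reg _ => 1
  | .load _ e => e.cost s + 1
  | .bin o e₁ e₂ => e₁.cost s + e₂.cost s + o.cost (e₁.eval s) (e₂.eval s)

/-- Programs: do nothing, `reg[r] := e`, `a[i] := e`, sequencing, branching on `e ≠ 0`, and
repeating the body as long as `e ≠ 0`. -/
inductive Prog where
  | nop
  | assign (r : ℕ) (e : Expr)
  | store (a : ℕ) (i e : Expr)
  | seq (P Q : Prog)
  | cond (e : Expr) (P Q : Prog)
  | loop (e : Expr) (P : Prog)

def State.setReg (s : State) (r v : ℕ) : State :=
  { s with reg := Function.update s.reg r v }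

def State.setArr (s : State) (a i v : ℕ) : State :=
  { s with arr := Function.update s.arr a (Function.update (s.arr a) i v) }

/-- `Exec P s s' t`: started in state `s`, the program `P` halts in state `s'` after time `t`. -/
inductive Exec : Prog → State → State → ℕ → Prop
  | nop (s : State) : Exec .nop s s 1
  | assign (s : State) (r : ℕ) (e : Expr) :
      Exec (.assign r e) s (s.setReg r (e.eval s)) (e.cost s + 1)
  | store (s : State) (a : ℕ) (i e : Expr) :
      Exec (.store a i e) s (s.setArr a (i.eval s) (e.eval s)) (i.cost s + e.cost s + 1)
  | seq {P Q : Prog} {s s' s'' : State} {t t' : ℕ} :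
      Exec P s s' t → Exec Q s' s'' t' → Exec (.seq P Q) s s'' (t + t')
  | cond_true {e : Expr} {P Q : Prog} {s s' : State} {t : ℕ} :
      e.eval s ≠ 0 → Exec P s s' t → Exec (.cond e P Q) s s' (e.cost s + 1 + t)
  | cond_false {e : Expr} {P Q : Prog} {s s' : State} {t : ℕ} :
      e.eval s = 0 → Exec Q s s' t → Exec (.cond e P Q) s s' (e.cost s + 1 + t)
  | loop_true {e : Expr} {P : Prog} {s s' s'' : State} {t t' : ℕ} :
      e.eval s ≠ 0 → Exec P s s' t → Exec (.loop e P) s' s'' t' →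
        Exec (.loop e P) s s'' (e.cost s + 1 + t + t')
  | loop_false {e : Expr} {P : Prog} {s : State} :
      e.eval s = 0 → Exec (.loop e P) s s (e.cost s + 1)

end RAM

namespace Blotto

/-- Initial memory for the instance `G` and the target utility `u`: registers `0, …, 4` hold `k`,
`n`, `m` and the numerator and denominator of `u`, array `0` holds the weights, everything else
is zero. -/
def input (G : Blotto) (u : ℚ≥0) : RAM.State where
  reg r := match r with
    | 0 => G.k
    | 1 => G.n
    | 2 => G.m
    | 3 => u.num
    | 4 => u.den
    | _ => 0
  arr a i := if h : a = 0 ∧ i < G.k then G.w ⟨i, h.2⟩ else 0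

/-- Input length: troops are counted in unary, weights and the target utility in binary. -/
def inputSize (G : Blotto) (u : ℚ≥0) : ℕ :=
  G.n + G.m + ∑ i, (G.w i).size + u.num.size + u.den.size

/-- In the final memory `s`, array `1` holds the pure strategy `x` of player 1. -/
def IsOutput (G : Blotto) (s : RAM.State) (x : G.Pure G.n) : Prop :=
  ∀ i : Fin G.k, s.arr 1 i = x.1 i

end Blotto

/-!
A pure strategy `x` fails to be `(u, 1)`-maxmin exactly if player 2 can leave some set `T` of
battlefields of total weight less than `u` to player 1 and match his troops on all the others, that
is, if at most `m` troops of `x` lie outside `T` (`Blotto.isPureMaxmin_iff_forall_finset`). So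
player 1 looks for an `x` for which the knapsack problem of maximizing the number `x(T)` of troops
on a set `T` of weight less than `u` has a small value compared with the total number of troops. A
solution that is almost as good is found by a dynamic program over the battlefields.

Fix an integer `L ≥ 3 / ε`, and call a battlefield heavy if its weight is at least `u / L`.

* The weights of heavy battlefields are rounded down to multiples of `u / L²`. As `T` has at most
  `L` heavy elements, this costs at most `u / L`. For each of the constantly many capacities `j`,
  the largest number of troops on a set of heavy battlefields of rounded weight at most `j` is kept
  (`Scaled.heavyMax`).
* The weights of light battlefields are rounded down to multiples of `u / (L² k)`, which costs at
  most `u / L` and makes them polynomially bounded. For the light part of `T` the knapsack value at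
  capacity `β` is replaced by its Lagrangian bound `λ β + ∑ (x i - λ w i)⁺`. This bound holds for
  every price `λ`, and for a suitable one it is attained by an integral set that exceeds the
  capacity by at most one light battlefield (`exists_price`), hence by at most `u / L`. The suitable
  price is a quotient of two polynomially bounded numbers.

Thus, after the prices for all capacities have been guessed, the acceptability of `x` depends on
constantly many polynomially bounded numbers (`Scaled.Certified`), each of which is updated easily
when a battlefield is added. By weak duality, a certified `x` guarantees `(1 - 3 / L) u`
(`Scaled.Certified.sound`); conversely, every `x` that guarantees `u` is certified by some prices
(`Scaled.exists_certified`). The program `Scaled.Code.main` runs through all guesses and searches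
for a certified strategy with a table indexed by the number of battlefields that are left and the
code of the state (`Scaled.choice`).

For the running time, all loops have explicit polynomial numbers of rounds, the program only
evaluates a fixed list of expressions, and all cells of the memory hold numbers of at most `b` bits
for a polynomial `b`, so that each evaluation takes time `O(b)` (`RAM.State.BitsLE.expr`).
-/

namespace RAM

/-! ### Arithmetic expressions -/

namespace Expr

instance : Add Expr := ⟨.bin .add⟩
instance : Sub Expr := ⟨.bin .sub⟩
instance : Mul Expr := ⟨.bin .mul⟩
instance : Div Expr := ⟨.bin .div⟩

/-- The remainder of a division. -/
def mod (a b : Expr) : Expr := a - b * (a / b)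

/-- The value of `a` if `c` is nonzero, and that of `b` otherwise. Both are evaluated. -/
def ite (c a b : Expr) : Expr := (const 1 - (const 1 - c)) * a + (const 1 - c) * b

/-- A power with a fixed exponent. -/
def pow (e : Expr) : ℕ → Expr
  | 0 => const 1
  | n + 1 => pow e n * e

/-- The sum of `f 0, …, f (n - 1)` for a fixed `n`. -/
def sum (f : ℕ → Expr) : ℕ → Expr
  | 0 => const 0
  | n + 1 => sum f n + f n

/-- The product of `f 0, …, f (n - 1)` for a fixed `n`. -/
def prod (f : ℕ → Expr) : ℕ → Expr
  | 0 => const 1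
  | n + 1 => prod f n * f n

variable (s : State)

@[simp] theorem eval_const (c : ℕ) : (const c).eval s = c := rfl
@[simp] theorem eval_reg (r : ℕ) : (reg r).eval s = s.reg r := rfl
@[simp] theorem eval_load (a : ℕ) (e : Expr) : (load a e).eval s = s.arr a (e.eval s) := rfl
@[simp] theorem eval_add (a b : Expr) : (a + b).eval s = a.eval s + b.eval s := rfl
@[simp] theorem eval_sub (a b : Expr) : (a - b).eval s = a.eval s - b.eval s := rfl
@[simp] theorem eval_mul (a b : Expr) : (a * b).eval s = a.eval s * b.eval s := rfl
@[simp] theorem eval_div (a b : Expr) : (a / b).eval s = a.eval s / b.eval s := rfl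

@[simp] theorem eval_mod (a b : Expr) : (mod a b).eval s = a.eval s % b.eval s := by
  simp [mod, Nat.mod_eq_sub_mul_div]

@[simp] theorem eval_ite (c a b : Expr) :
    (ite c a b).eval s = if c.eval s ≠ 0 then a.eval s else b.eval s := by
  rcases Nat.eq_zero_or_pos (c.eval s) with h | h
  · simp [ite, h]
  · have h1 : 1 - c.eval s = 0 := by omega
    simp [ite, h.ne', h1]

@[simp] theorem eval_pow (e : Expr) (n : ℕ) : (pow e n).eval s = e.eval s ^ n := by
  induction n with
  | zero => rfl
  | succ n ih => simp [pow, ih, pow_succ]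

@[simp] theorem eval_sum (f : ℕ → Expr) (n : ℕ) :
    (sum f n).eval s = ∑ i ∈ Finset.range n, (f i).eval s := by
  induction n with
  | zero => rfl
  | succ n ih => simp [sum, ih, Finset.sum_range_succ]

@[simp] theorem eval_prod (f : ℕ → Expr) (n : ℕ) :
    (prod f n).eval s = ∏ i ∈ Finset.range n, (f i).eval s := by
  induction n with
  | zero => rfl
  | succ n ih => simp [prod, ih, Finset.prod_range_succ]

/-- A constant `C` such that, in a memory of cells of at most `b` bits, the expression has a value
of at most `C * (b + 1)` bits and is evaluated in time `C * (b + 1)`. -/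
def bitFactor : Expr → ℕ
  | .const c => c.size + 1
  | .reg _ => 1
  | .load _ e => e.bitFactor + 1
  | .bin _ e₁ e₂ => 2 * e₁.bitFactor + 2 * e₂.bitFactor + 1

end Expr

/-- Every memory cell holds a number of at most `b` bits. -/
def State.BitsLE (s : State) (b : ℕ) : Prop :=
  (∀ r, (s.reg r).size ≤ b) ∧ ∀ a i, (s.arr a i).size ≤ b

theorem size_le_of_le {a b : ℕ} (h : a ≤ b) : a.size ≤ b :=
  Nat.size_le.2 (h.trans_lt Nat.lt_two_pow_self)

theorem BinOp.size_eval_le (o : BinOp) (a b : ℕ) : (o.eval a b).size ≤ a.size + b.size + 1 := by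
  have ha := Nat.lt_size_self a
  have hb := Nat.lt_size_self b
  have h1 : 2 ^ a.size ≤ 2 ^ (a.size + b.size) := Nat.pow_le_pow_right two_pos (by omega)
  have h2 : 2 ^ b.size ≤ 2 ^ (a.size + b.size) := Nat.pow_le_pow_right two_pos (by omega)
  cases o with
  | add =>
    refine Nat.size_le.2 ?_
    simp only [BinOp.eval, pow_succ]
    omega
  | sub => exact (Nat.size_le_size (Nat.sub_le a b)).trans (by omega)
  | mul =>
    refine (Nat.size_le.2 ?_).trans (Nat.le_succ _)
    rw [pow_add]
    exact Nat.mul_lt_mul'' ha hb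
  | div => exact (Nat.size_le_size (Nat.div_le_self a b)).trans (by omega)

theorem BinOp.cost_le (o : BinOp) (a b : ℕ) : o.cost a b ≤ a.size + b.size + 1 := by
  cases o <;> simp only [BinOp.cost] <;> omega

theorem State.BitsLE.expr {s : State} {b : ℕ} (h : s.BitsLE b) (e : Expr) :
    (e.eval s).size ≤ e.bitFactor * (b + 1) ∧ e.cost s ≤ e.bitFactor * (b + 1) := by
  induction e with
  | const c =>
    simp only [Expr.eval, Expr.cost, Expr.bitFactor]
    constructor <;> nlinarith
  | reg r =>
    have := h.1 r
    simp only [Expr.eval, Expr.cost, Expr.bitFactor]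
    omega
  | load a e ih =>
    have := h.2 a (e.eval s)
    simp only [Expr.eval, Expr.cost, Expr.bitFactor]
    constructor <;> nlinarith
  | bin o e₁ e₂ ih₁ ih₂ =>
    have h1 := o.size_eval_le (e₁.eval s) (e₂.eval s)
    have h2 := o.cost_le (e₁.eval s) (e₂.eval s)
    simp only [Expr.eval, Expr.cost, Expr.bitFactor]
    constructor <;> nlinarith

theorem State.BitsLE.setReg {s : State} {b : ℕ} (h : s.BitsLE b) (r : ℕ) {v : ℕ}
    (hv : v.size ≤ b) : (s.setReg r v).BitsLE b := by
  refine ⟨fun r' => ?_, h.2⟩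
  by_cases hr : r' = r
  · subst hr; simpa [State.setReg] using hv
  · simpa [State.setReg, hr] using h.1 r'

theorem State.BitsLE.setArr {s : State} {b : ℕ} (h : s.BitsLE b) (a i : ℕ) {v : ℕ}
    (hv : v.size ≤ b) : (s.setArr a i v).BitsLE b := by
  refine ⟨h.1, fun a' i' => ?_⟩
  by_cases ha : a' = a
  · subst ha
    by_cases hi : i' = i
    · subst hi; simpa [State.setArr] using hv
    · simpa [State.setArr, hi] using h.2 a' i'
  · simpa [State.setArr, ha] using h.2 a' i'

@[simp] theorem State.setReg_reg (s : State) (r v r' : ℕ) :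
    (s.setReg r v).reg r' = if r' = r then v else s.reg r' := by
  simp [State.setReg, Function.update_apply]

@[simp] theorem State.setReg_arr (s : State) (r v : ℕ) : (s.setReg r v).arr = s.arr := rfl

@[simp] theorem State.setArr_reg (s : State) (a i v : ℕ) : (s.setArr a i v).reg = s.reg := rfl

@[simp] theorem State.setArr_arr (s : State) (a i v a' : ℕ) :
    (s.setArr a i v).arr a' = if a' = a then Function.update (s.arr a) i v else s.arr a' := by
  by_cases h : a' = a
  · subst h; simp [State.setArr]
  · simp [State.setArr, h]

/-! ### Total correctness with running times -/

/-- Started in `s`, the program `P` halts within time `T` in a state that satisfies `Q`. -/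
def Runs (P : Prog) (s : State) (T : ℕ) (Q : State → Prop) : Prop :=
  ∃ s' t, Exec P s s' t ∧ t ≤ T ∧ Q s'

namespace Runs

variable {P P' : Prog} {s : State} {T T' τ : ℕ} {Q Q' : State → Prop} {e e' : Expr}

theorem mono (h : Runs P s T Q) (hT : T ≤ T') (hQ : ∀ s', Q s' → Q' s') : Runs P s T' Q' := by
  obtain ⟨s', t, hs, ht, hq⟩ := h
  exact ⟨s', t, hs, ht.trans hT, hQ _ hq⟩

theorem nop (hQ : Q s) : Runs .nop s 1 Q := ⟨_, _, .nop s, le_rfl, hQ⟩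

theorem assign {r : ℕ} (he : e.cost s ≤ τ) (hQ : Q (s.setReg r (e.eval s))) :
    Runs (.assign r e) s (τ + 1) Q :=
  ⟨_, _, .assign s r e, by omega, hQ⟩

theorem store {a : ℕ} (he : e.cost s ≤ τ) (he' : e'.cost s ≤ τ)
    (hQ : Q (s.setArr a (e.eval s) (e'.eval s))) : Runs (.store a e e') s (2 * τ + 1) Q :=
  ⟨_, _, .store s a e e', by omega, hQ⟩

theorem seq (h : Runs P s T Q) (h' : ∀ s', Q s' → Runs P' s' T' Q') :
    Runs (.seq P P') s (T + T') Q' := by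
  obtain ⟨s', t, hs, ht, hq⟩ := h
  obtain ⟨s'', t', hs', ht', hq'⟩ := h' s' hq
  exact ⟨s'', _, .seq hs hs', by omega, hq'⟩

theorem cond (he : e.cost s ≤ τ) (h : e.eval s ≠ 0 → Runs P s T Q)
    (h' : e.eval s = 0 → Runs P' s T Q) : Runs (.cond e P P') s (τ + 1 + T) Q := by
  by_cases h0 : e.eval s = 0
  · obtain ⟨s', t, hs, ht, hq⟩ := h' h0
    exact ⟨s', _, .cond_false h0 hs, by omega, hq⟩
  · obtain ⟨s', t, hs, ht, hq⟩ := h h0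
    exact ⟨s', _, .cond_true h0 hs, by omega, hq⟩

/-- A loop that is left after exactly `N` rounds, with an invariant `I` that counts them. -/
theorem loop (I : ℕ → State → Prop) (N : ℕ)
    (he : ∀ i s, i ≤ N → I i s → e.cost s ≤ τ ∧ (e.eval s = 0 ↔ i = N))
    (hP : ∀ i s, i < N → I i s → Runs P s T (I (i + 1))) (h0 : I 0 s) :
    Runs (.loop e P) s (N * (τ + 1 + T) + (τ + 1)) (I N) := by
  suffices H : ∀ d i s, i + d = N → I i s →
      Runs (.loop e P) s (d * (τ + 1 + T) + (τ + 1)) (I N) from H N 0 s (zero_add N) h0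
  intro d
  induction d with
  | zero =>
    intro i s hi hI
    obtain rfl : i = N := hi
    obtain ⟨hc, hz⟩ := he i s le_rfl hI
    exact ⟨s, _, .loop_false (hz.2 rfl), by omega, hI⟩
  | succ d ih =>
    intro i s hi hI
    obtain ⟨hc, hz⟩ := he i s (by omega) hI
    obtain ⟨s', t, hs, ht, hI'⟩ := hP i s (by omega) hI
    obtain ⟨s'', t', hs', ht', hI''⟩ := ih (i + 1) s' (by omega) hI'
    refine ⟨s'', _, .loop_true (fun h => ?_) hs hs', ?_, hI''⟩
    · have := hz.1 h
      omega
    · rw [Nat.succ_mul]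
      omega

theorem assign_seq {r : ℕ} (he : e.cost s ≤ τ) (h : Runs P (s.setReg r (e.eval s)) T Q) :
    Runs (.seq (.assign r e) P) s (τ + 1 + T) Q :=
  seq (assign (Q := (· = s.setReg r (e.eval s))) he rfl) fun _ hs => hs ▸ h

theorem store_seq {a : ℕ} (he : e.cost s ≤ τ) (he' : e'.cost s ≤ τ)
    (h : Runs P (s.setArr a (e.eval s) (e'.eval s)) T Q) :
    Runs (.seq (.store a e e') P) s (2 * τ + 1 + T) Q :=
  seq (store (Q := (· = s.setArr a (e.eval s) (e'.eval s))) he he' rfl) fun _ hs => hs ▸ h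

end Runs

/-- The expressions that a program evaluates. -/
def Prog.exprs : Prog → List Expr
  | .nop => []
  | .assign _ e => [e]
  | .store _ i e => [i, e]
  | .seq P Q => P.exprs ++ Q.exprs
  | .cond e P Q => e :: (P.exprs ++ Q.exprs)
  | .loop e P => e :: P.exprs

theorem State.BitsLE.cost_le {s : State} {b : ℕ} (h : s.BitsLE b) {l : List Expr} {e : Expr}
    (he : e ∈ l) : e.cost s ≤ (l.map Expr.bitFactor).sum * (b + 1) :=
  (h.expr e).2.trans (Nat.mul_le_mul_right _ (List.le_sum_of_mem (List.mem_map_of_mem he)))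

end RAM

/-! ### Pure maxmin strategies as a covering condition -/

namespace Blotto

/-- Against a pure strategy, winning with probability one against mixed strategies means winning
against pure ones. -/
theorem isPureMaxmin_iff (G : Blotto) (u : ℝ) (x : G.Pure G.n) :
    G.IsPureMaxmin u x ↔ ∀ y, u ≤ G.payoff x y := by
  unfold IsPureMaxmin IsMaxmin
  simp only [PMF.pure_bind]
  constructor
  · intro h y
    have := h (PMF.pure y)
    rw [PMF.pure_map, PMF.toOuterMeasure_pure_apply] at this
    by_contra hu
    simp [hu] at this
  · intro h Y
    refine ((PMF.toOuterMeasure_apply_eq_one_iff _ _).2 ?_).ge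
    intro z hz
    rw [PMF.mem_support_map_iff] at hz
    obtain ⟨y, -, rfl⟩ := hz
    exact h y

/-- A best response of player 2 wins the battlefields outside some set `T` by matching the troops
there, so the payoff can be pushed below `u` exactly if some `T` of weight less than `u` leaves at
most `m` troops of player 1 outside. -/
theorem isPureMaxmin_iff_forall_finset (G : Blotto) (u : ℝ) (x : G.Pure G.n) :
    G.IsPureMaxmin u x ↔ ∀ T : Finset (Fin G.k), ((∑ i ∈ T, G.w i : ℕ) : ℝ) < u →
      ∑ i ∈ T, x.1 i + G.m < ∑ i, x.1 i := by
  classical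
  rw [isPureMaxmin_iff]
  constructor
  · intro h T hT
    by_contra hc
    have hsplit := Finset.sum_add_sum_compl T x.1
    -- Player 2 gives up `T` and matches player 1 elsewhere.
    have hy : ∑ i, (if i ∈ T then 0 else x.1 i) ≤ G.m := by
      have : ∑ i, (if i ∈ T then 0 else x.1 i) = ∑ i ∈ Tᶜ, x.1 i := by
        rw [Finset.sum_ite, Finset.sum_const_zero, zero_add]
        congr 1
        ext
        simp
      omega
    refine (h ⟨_, hy⟩).not_gt (lt_of_le_of_lt ?_ hT)
    unfold payoff
    norm_cast
    refine Finset.sum_le_sum_of_subset fun i hi => ?_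
    by_contra hiT
    simp [hiT] at hi
  · intro h y
    by_contra hu
    push Not at hu
    have h1 := h _ hu
    have hsplit := Finset.sum_filter_add_sum_filter_not Finset.univ (fun i => y.1 i < x.1 i) x.1
    have h2 : ∑ i with ¬ y.1 i < x.1 i, x.1 i ≤ ∑ i, y.1 i :=
      (Finset.sum_le_sum fun i hi => not_lt.1 (Finset.mem_filter.1 hi).2).trans
        (Finset.sum_le_sum_of_subset (Finset.filter_subset _ _))
    have := y.2
    omega

end Blotto

/-! ### Duality for the knapsack problem with small items -/

/-- If the items do not fit, the price can be taken to be the density of one of them. This is what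
keeps the price from dropping below the densities of the items that have been removed. -/
theorem exists_density_of_lt_sum {ι : Type*} [DecidableEq ι] (x l : ι → ℕ) (β M : ℕ) (I : Finset ι)
    (hM : ∀ i ∈ I, l i ≤ M) (hI : β + M < ∑ i ∈ I, l i) :
    ∃ f ∈ I, 0 < l f ∧ ∃ T ⊆ I, ∑ i ∈ T, l i ≤ β + M ∧
      x f * β + ∑ i ∈ I, (l f * x i - x f * l i) ≤ l f * ∑ i ∈ T, x i := by
  induction I using Finset.strongInduction with
  | H I ih =>
    have hne : (I.filter fun i => 0 < l i).Nonempty := by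
      by_contra hc
      rw [Finset.not_nonempty_iff_eq_empty, Finset.filter_eq_empty_iff] at hc
      have : ∑ i ∈ I, l i = 0 := Finset.sum_eq_zero fun i hi => by have := hc hi; omega
      omega
    -- `f` has the least density among the items of positive size.
    obtain ⟨f, hf, hmin⟩ := Finset.exists_min_image _ (fun i => (x i : ℚ) / l i) hne
    rw [Finset.mem_filter] at hf
    have hmin' : ∀ i ∈ I, x f * l i ≤ l f * x i := by
      intro i hi
      rcases Nat.eq_zero_or_pos (l i) with h0 | h0
      · simp [h0]
      · have := hmin i (Finset.mem_filter.2 ⟨hi, h0⟩)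
        rw [div_le_div_iff₀ (by exact_mod_cast hf.2) (by exact_mod_cast h0)] at this
        have h2 : x f * l i ≤ x i * l f := by exact_mod_cast this
        linarith
    have hl := Finset.add_sum_erase I l hf.1
    have hlM := hM f hf.1
    by_cases hc : ∑ i ∈ I.erase f, l i ≤ β + M
    · refine ⟨f, hf.1, hf.2, I.erase f, Finset.erase_subset _ _, hc, ?_⟩
      have hx := Finset.add_sum_erase I x hf.1
      have h3 : ∑ i ∈ I, (l f * x i - x f * l i) + x f * ∑ i ∈ I, l i = l f * ∑ i ∈ I, x i := by
        rw [Finset.mul_sum, Finset.mul_sum, ← Finset.sum_add_distrib]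
        exact Finset.sum_congr rfl fun i hi => Nat.sub_add_cancel (hmin' i hi)
      have h4 : x f * β ≤ x f * ∑ i ∈ I.erase f, l i := Nat.mul_le_mul_left _ (by omega)
      rw [← hl, ← hx, mul_add, mul_add, mul_comm (l f) (x f)] at h3
      omega
    · obtain ⟨e, he, he0, T, hT, hTl, hTx⟩ := ih (I.erase f) (Finset.erase_ssubset hf.1)
        (fun i hi => hM i (Finset.mem_of_mem_erase hi)) (by omega)
      refine ⟨e, Finset.mem_of_mem_erase he, he0, T, hT.trans (Finset.erase_subset _ _), hTl, ?_⟩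
      -- The density of `e` is at least that of `f`, so `f` adds nothing to the sum.
      have h5 : l e * x f - x e * l f = 0 := by
        have := hmin' e (Finset.mem_of_mem_erase he)
        rw [mul_comm (l e), mul_comm (x e)]
        omega
      rwa [← Finset.add_sum_erase _ _ hf.1, h5, zero_add]

/-- The Lagrangian bound `λ β + ∑ (x i - λ l i)⁺` on the value of a knapsack of capacity `β` is
attained by an integral set, for some price `λ = p / q`, once the capacity is exceeded by the size
`M` of the largest item: remove items in the order of increasing density `x i / l i` until the
rest fits. -/
theorem exists_price (x l : ℕ → ℕ) (β M n : ℕ) (I : Finset ℕ) (hM : ∀ i ∈ I, l i ≤ M)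
    (hn : ∀ i ∈ I, x i ≤ n) :
    ∃ p q, p ≤ n ∧ q ≤ M + 1 ∧ 0 < q ∧ ∃ T ⊆ I, ∑ i ∈ T, l i ≤ β + M ∧
      p * β + ∑ i ∈ I, (q * x i - p * l i) ≤ q * ∑ i ∈ T, x i := by
  by_cases h : ∑ i ∈ I, l i ≤ β + M
  · exact ⟨0, 1, Nat.zero_le _, by omega, one_pos, I, subset_rfl, h, by simp⟩
  · obtain ⟨f, hf, hf0, hT⟩ := exists_density_of_lt_sum x l β M I hM (by omega)
    exact ⟨x f, l f, hn f hf, by have := hM f hf; omega, hf0, hT⟩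

/-! ### Digits -/

/-- The digit number `t` of `c` to the base `b`. -/
def digit (b c t : ℕ) : ℕ := c / b ^ t % b

/-- The number with the digits `f 0, …, f (N - 1)` to the base `b`. -/
def encode (b N : ℕ) (f : ℕ → ℕ) : ℕ := ∑ t ∈ Finset.range N, f t * b ^ t

theorem encode_lt {b N : ℕ} {f : ℕ → ℕ} (hf : ∀ t < N, f t < b) : encode b N f < b ^ N := by
  induction N with
  | zero => simp [encode]
  | succ N ih =>
    have h1 := ih fun t ht => hf t (by omega)
    have h2 : (f N + 1) * b ^ N ≤ b * b ^ N := Nat.mul_le_mul_right _ (hf N (by omega))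
    rw [encode] at h1 ⊢
    rw [Finset.sum_range_succ, pow_succ']
    linarith

theorem digit_encode {b N t : ℕ} {f : ℕ → ℕ} (hf : ∀ t < N, f t < b) (ht : t < N) :
    digit b (encode b N f) t = f t := by
  have hb : 0 < b := (Nat.zero_le _).trans_lt (hf t ht)
  induction N with
  | zero => omega
  | succ N ih =>
    have hlt := encode_lt (N := N) fun t ht => hf t (by omega)
    have hs : encode b (N + 1) f = encode b N f + f N * b ^ N := Finset.sum_range_succ _ _
    rcases Nat.lt_succ_iff_lt_or_eq.1 ht with h | rfl
    · rw [← ih (fun t ht => hf t (by omega)) h, digit, digit, hs]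
      obtain ⟨d, rfl⟩ : ∃ d, N = t + 1 + d := ⟨N - (t + 1), by omega⟩
      rw [show f (t + 1 + d) * b ^ (t + 1 + d) = b ^ t * (b * (f (t + 1 + d) * b ^ d)) by ring,
        Nat.add_mul_div_left _ _ (pow_pos hb t), Nat.add_mul_mod_self_left]
    · rw [digit, hs, Nat.add_mul_div_right _ _ (pow_pos hb t), Nat.div_eq_of_lt hlt, zero_add,
        Nat.mod_eq_of_lt (hf t ht)]

theorem encode_congr {b N : ℕ} {f f' : ℕ → ℕ} (h : ∀ t < N, f t = f' t) :
    encode b N f = encode b N f' :=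
  Finset.sum_congr rfl fun t ht => by rw [h t (Finset.mem_range.1 ht)]

/-! ### Scaled weights and certificates -/

/-- The data of an instance with `k` battlefields of weights `w 0, …, w (k - 1)`, where `num / den`
is the target utility, together with the accuracy `L`. -/
structure Scaled (L : ℕ) where
  k : ℕ
  n : ℕ
  m : ℕ
  num : ℕ
  den : ℕ
  w : ℕ → ℕ

namespace Scaled

variable {L : ℕ} (P : Scaled L)

/-- The weight of a battlefield in units of `1 / (L² k)` of the target utility, rounded down. -/
def weight (i : ℕ) : ℕ := L * L * P.k * P.w i * P.den / P.num

/-- A battlefield is heavy if its weight is at least `1 / L` of the target utility. -/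
def Heavy (i : ℕ) : Prop := P.k * L ≤ P.weight i

instance : DecidablePred P.Heavy := fun _ => inferInstanceAs (Decidable (_ ≤ _))

/-- The weight in units of `1 / L²` of the target utility, rounded down. -/
def coarse (i : ℕ) : ℕ := P.weight i / P.k

/-- The number of capacities `0, …, L (L - 3)`, in units of `1 / L²` of the target utility, for
which the best sets of heavy battlefields are recorded. The largest one is `1 - 3 / L` of the target
utility. -/
def numCap (L : ℕ) : ℕ := L * (L - 3) + 1

/-- The largest number of troops on a set of heavy battlefields among the first `i` ones whose total
coarse weight is at most `j`. -/
def heavyMax (x : ℕ → ℕ) : ℕ → ℕ → ℕ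
  | 0, _ => 0
  | i + 1, j =>
    if P.Heavy i ∧ P.coarse i ≤ j then
      max (heavyMax x i j) (heavyMax x i (j - P.coarse i) + x i)
    else heavyMax x i j

/-- The excess `∑ (q x i - p weight i)⁺` over the light battlefields among the first `i` ones. -/
def lightExcess (p q : ℕ) (x : ℕ → ℕ) (i : ℕ) : ℕ :=
  ∑ a ∈ (Finset.range i).filter (¬ P.Heavy ·), (q * x a - p * P.weight a)

/-- The prices `p j / q j` certify the strategy `x`: for every capacity `j`, if the set that
player 2 leaves to player 1 consists of heavy battlefields of coarse weight at most `j` and light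
ones within the remaining weight, then more than `m` troops lie outside it, because so many remain
when the troops on the heavy part are bounded by `heavyMax` and those on the light part by the
Lagrangian bound for the price `p j / q j`. Everything is multiplied by `q j`. -/
def Certified (p q : ℕ → ℕ) (x : ℕ → ℕ) : Prop :=
  ∀ j < numCap L, q j * (P.heavyMax x P.k j + P.m) + p j * (P.k * (numCap L - 1 - j)) +
    P.lightExcess (p j) (q j) x P.k < q j * ∑ i ∈ Finset.range P.k, x i

variable {P}

theorem le_heavyMax (x : ℕ → ℕ) (i j : ℕ) (T : Finset ℕ) (hT : T ⊆ Finset.range i)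
    (hH : ∀ a ∈ T, P.Heavy a) (hj : ∑ a ∈ T, P.coarse a ≤ j) :
    ∑ a ∈ T, x a ≤ P.heavyMax x i j := by
  induction i generalizing j T with
  | zero =>
    rw [Finset.range_zero, Finset.subset_empty] at hT
    simp [hT]
  | succ i ih =>
    by_cases hi : i ∈ T
    · have hs := Finset.add_sum_erase T P.coarse hi
      have hx := Finset.add_sum_erase T x hi
      have hsub : T.erase i ⊆ Finset.range i := by
        intro a ha
        have h1 := Finset.mem_range.1 (hT (Finset.mem_of_mem_erase ha))
        have h2 := Finset.ne_of_mem_erase ha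
        exact Finset.mem_range.2 (by omega)
      have := ih (j - P.coarse i) (T.erase i) hsub
        (fun a ha => hH a (Finset.mem_of_mem_erase ha)) (by omega)
      rw [heavyMax, if_pos ⟨hH i hi, by omega⟩]
      exact le_max_of_le_right (by omega)
    · have hsub : T ⊆ Finset.range i := by
        intro a ha
        have h1 := Finset.mem_range.1 (hT ha)
        have h2 : a ≠ i := fun h => hi (h ▸ ha)
        exact Finset.mem_range.2 (by omega)
      have := ih j T hsub hH hj
      rw [heavyMax]
      split_ifs
      · exact le_max_of_le_left this
      · exact this

theorem exists_eq_heavyMax (P : Scaled L) (x : ℕ → ℕ) (i j : ℕ) :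
    ∃ T ⊆ Finset.range i, (∀ a ∈ T, P.Heavy a) ∧ ∑ a ∈ T, P.coarse a ≤ j ∧
      ∑ a ∈ T, x a = P.heavyMax x i j := by
  induction i generalizing j with
  | zero => exact ⟨∅, by simp, by simp, by simp, by simp [heavyMax]⟩
  | succ i ih =>
    have hmono : Finset.range i ⊆ Finset.range (i + 1) := Finset.range_subset_range.2 i.le_succ
    obtain ⟨T, hT, hH, hj, hx⟩ := ih j
    rw [heavyMax]
    split_ifs with hc
    · rcases le_total (P.heavyMax x i (j - P.coarse i) + x i) (P.heavyMax x i j) with h | h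
      · exact ⟨T, hT.trans hmono, hH, hj, by rw [max_eq_left h, hx]⟩
      · obtain ⟨T', hT', hH', hj', hx'⟩ := ih (j - P.coarse i)
        have hi : i ∉ T' := fun h => by simpa using hT' h
        refine ⟨insert i T', ?_, ?_, ?_, ?_⟩
        · exact Finset.insert_subset (by simp) (hT'.trans hmono)
        · intro a ha
          rcases Finset.mem_insert.1 ha with rfl | ha
          exacts [hc.1, hH' a ha]
        · rw [Finset.sum_insert hi]
          omega
        · rw [Finset.sum_insert hi, hx', max_eq_right h, add_comm]
    · exact ⟨T, hT.trans hmono, hH, hj, hx⟩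

theorem heavyMax_le (P : Scaled L) (x : ℕ → ℕ) (i j : ℕ) :
    P.heavyMax x i j ≤ ∑ a ∈ Finset.range i, x a := by
  obtain ⟨T, hT, -, -, hx⟩ := P.exists_eq_heavyMax x i j
  exact hx ▸ Finset.sum_le_sum_of_subset hT

theorem lightExcess_le (P : Scaled L) (p q : ℕ) (x : ℕ → ℕ) (i : ℕ) :
    P.lightExcess p q x i ≤ q * ∑ a ∈ Finset.range i, x a := by
  rw [Finset.mul_sum]
  exact (Finset.sum_le_sum fun a _ => Nat.sub_le _ _).trans
    (Finset.sum_le_sum_of_subset (Finset.filter_subset _ _))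

theorem lightExcess_succ (P : Scaled L) (p q : ℕ) (x : ℕ → ℕ) (i : ℕ) :
    P.lightExcess p q x (i + 1) =
      P.lightExcess p q x i + if P.Heavy i then 0 else q * x i - p * P.weight i := by
  unfold lightExcess
  rw [Finset.range_add_one, Finset.filter_insert]
  split_ifs with h
  · simp_all
  · rw [Finset.sum_insert (by simp), add_comm]

/-- Weak duality: a certified strategy guarantees `1 - 3 / L` of the target utility. -/
theorem Certified.sound {p q x : ℕ → ℕ} (h : P.Certified p q x) (hnum : 0 < P.num)
    (T : Finset ℕ) (hT : T ⊆ Finset.range P.k)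
    (hw : L * (∑ i ∈ T, P.w i) * P.den ≤ (L - 3) * P.num) :
    ∑ i ∈ T, x i + P.m < ∑ i ∈ Finset.range P.k, x i := by
  have hv : ∑ i ∈ T, P.weight i ≤ P.k * (L * (L - 3)) := by
    have h1 : (∑ i ∈ T, P.weight i) * P.num ≤ L * L * P.k * (∑ i ∈ T, P.w i) * P.den := by
      rw [Finset.sum_mul, Finset.mul_sum, Finset.sum_mul]
      exact Finset.sum_le_sum fun i _ => Nat.div_mul_le_self _ _
    have h2 := Nat.mul_le_mul_left (L * P.k) hw
    refine Nat.le_of_mul_le_mul_right (h1.trans ?_) hnum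
    calc _ = L * P.k * (L * (∑ i ∈ T, P.w i) * P.den) := by ring
      _ ≤ _ := h2
      _ = _ := by ring
  have hsplit (f : ℕ → ℕ) := Finset.sum_filter_add_sum_filter_not T P.Heavy f
  set TH := T.filter P.Heavy
  set TL := T.filter (¬ P.Heavy ·)
  set j := ∑ i ∈ TH, P.coarse i with hj
  have hkj : P.k * j ≤ ∑ i ∈ TH, P.weight i := by
    rw [hj, Finset.mul_sum]
    exact Finset.sum_le_sum fun i _ => Nat.mul_div_le _ _
  have hjD : j ≤ L * (L - 3) := by
    -- Without battlefields, `coarse` divides by zero, but then there are no summands.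
    rcases Nat.eq_zero_or_pos P.k with hk | hk
    · have : TH = ∅ :=
        Finset.subset_empty.1 ((Finset.filter_subset _ _).trans (by simpa [hk] using hT))
      simp [hj, this]
    · exact Nat.le_of_mul_le_mul_left (hkj.trans (by have := hsplit P.weight; omega)) hk
  have hjD' : j < numCap L := Nat.lt_succ_of_le hjD
  have hcert := h j hjD'
  have hH := le_heavyMax x P.k j TH ((Finset.filter_subset _ _).trans hT)
    (fun a ha => (Finset.mem_filter.1 ha).2) le_rfl
  have hL : ∑ i ∈ TL, P.weight i ≤ P.k * (numCap L - 1 - j) := by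
    have := hsplit P.weight
    rw [numCap, Nat.add_sub_cancel, Nat.mul_sub]
    omega
  have hlag : q j * ∑ i ∈ TL, x i ≤
      p j * ∑ i ∈ TL, P.weight i + P.lightExcess (p j) (q j) x P.k := by
    have h1 : ∑ i ∈ TL, (q j * x i - p j * P.weight i) ≤ P.lightExcess (p j) (q j) x P.k :=
      Finset.sum_le_sum_of_subset (Finset.filter_subset_filter _ hT)
    have h2 : ∑ i ∈ TL, q j * x i ≤
        ∑ i ∈ TL, (p j * P.weight i + (q j * x i - p j * P.weight i)) :=
      Finset.sum_le_sum fun i _ => by omega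
    rw [Finset.sum_add_distrib, ← Finset.mul_sum, ← Finset.mul_sum] at h2
    omega
  refine Nat.lt_of_mul_lt_mul_left (a := q j) (lt_of_le_of_lt ?_ hcert)
  have h3 := Nat.mul_le_mul_left (p j) hL
  have h4 := Nat.mul_le_mul_left (q j) hH
  rw [← hsplit x]
  calc _ = q j * (∑ i ∈ TH, x i) + q j * (∑ i ∈ TL, x i) + q j * P.m := by ring
    _ ≤ q j * P.heavyMax x P.k j +
        (p j * (P.k * (numCap L - 1 - j)) + P.lightExcess (p j) (q j) x P.k) + q j * P.m := by omega
    _ = _ := by ring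

/-- A strategy that guarantees the target utility has a certificate. The rounding of the heavy
weights, that of the light weights, and the capacity exceeded by a light battlefield cost at most
`1 / L` of the target utility each. -/
theorem exists_certified (hL : 3 ≤ L) (hnum : 0 < P.num) (x : ℕ → ℕ) (n : ℕ)
    (hn : ∑ i ∈ Finset.range P.k, x i ≤ n)
    (h : ∀ T ⊆ Finset.range P.k, (∑ i ∈ T, P.w i) * P.den < P.num →
      ∑ i ∈ T, x i + P.m < ∑ i ∈ Finset.range P.k, x i) :
    ∃ p q : ℕ → ℕ, (∀ j, p j ≤ n) ∧ (∀ j, q j ≤ P.k * L + 1) ∧ P.Certified p q x := by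
  have hk : 0 < P.k := by
    rcases Nat.eq_zero_or_pos P.k with hk | hk
    · have := h ∅ (by simp) (by simpa using hnum)
      simp [hk] at this
    · exact hk
  have hprice : ∀ j, ∃ p q, p ≤ n ∧ q ≤ P.k * L + 1 ∧ 0 < q ∧
      ∃ T ⊆ (Finset.range P.k).filter (¬ P.Heavy ·),
        ∑ i ∈ T, P.weight i ≤ P.k * (numCap L - 1 - j) + P.k * L ∧
        p * (P.k * (numCap L - 1 - j)) + P.lightExcess p q x P.k ≤ q * ∑ i ∈ T, x i := by
    intro j
    refine exists_price x P.weight _ _ n _ (fun i hi => ?_) (fun i hi => ?_)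
    · exact (not_le.1 (Finset.mem_filter.1 hi).2).le
    · exact (Finset.single_le_sum (fun _ _ => Nat.zero_le _) (Finset.mem_filter.1 hi).1).trans hn
  choose p q hp hq hq0 TL hTL hTLw hTLx using hprice
  refine ⟨p, q, hp, hq, fun j hj => ?_⟩
  obtain ⟨TH, hTH, hTHh, hTHj, hTHx⟩ := P.exists_eq_heavyMax x P.k j
  have hdisj : Disjoint TH (TL j) := by
    rw [Finset.disjoint_left]
    intro a ha hb
    exact (Finset.mem_filter.1 (hTL j hb)).2 (hTHh a ha)
  have hsub : TH ∪ TL j ⊆ Finset.range P.k :=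
    Finset.union_subset hTH ((hTL j).trans (Finset.filter_subset _ _))
  have hw : (∑ i ∈ TH ∪ TL j, P.w i) * P.den < P.num := by
    have hround : L * L * P.k * ((∑ i ∈ TH ∪ TL j, P.w i) * P.den) ≤
        (∑ i ∈ TH ∪ TL j, (P.weight i + 1)) * P.num := by
      rw [Finset.sum_mul, Finset.mul_sum, Finset.sum_mul]
      refine Finset.sum_le_sum fun i _ => ?_
      rw [← mul_assoc]
      exact (Nat.lt_mul_of_div_lt (Nat.lt_succ_self _) hnum).le
    have hTHcard : TH.card ≤ L := by
      have h1 : TH.card * L ≤ ∑ a ∈ TH, P.coarse a := by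
        rw [← smul_eq_mul]
        exact Finset.card_nsmul_le_sum _ _ _ fun a ha =>
          (Nat.le_div_iff_mul_le hk).2 (by rw [mul_comm]; exact hTHh a ha)
      have h2 : j ≤ L * L := (Nat.le_of_lt_succ hj).trans (Nat.mul_le_mul_left _ (Nat.sub_le _ _))
      exact Nat.le_of_mul_le_mul_right (h1.trans (hTHj.trans h2)) (by omega)
    have hTHw : ∑ i ∈ TH, (P.weight i + 1) ≤ P.k * j + P.k * L := by
      calc _ ≤ ∑ i ∈ TH, (P.k * P.coarse i + P.k) := by
            refine Finset.sum_le_sum fun i _ => ?_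
            have h1 := Nat.div_add_mod (P.weight i) P.k
            have h2 := Nat.mod_lt (P.weight i) hk
            rw [coarse]
            omega
        _ = P.k * ∑ i ∈ TH, P.coarse i + P.k * TH.card := by
            rw [Finset.sum_add_distrib, Finset.mul_sum, Finset.sum_const, smul_eq_mul,
              mul_comm TH.card]
        _ ≤ _ := Nat.add_le_add (Nat.mul_le_mul_left _ hTHj) (Nat.mul_le_mul_left _ hTHcard)
    have hTLcard : (TL j).card ≤ P.k := by
      simpa using Finset.card_le_card ((hTL j).trans (Finset.filter_subset _ _))
    have hTLw' : ∑ i ∈ TL j, (P.weight i + 1) ≤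
        P.k * (numCap L - 1 - j) + P.k * L + P.k := by
      rw [Finset.sum_add_distrib, Finset.sum_const, smul_eq_mul, mul_one]
      exact Nat.add_le_add (hTLw j) hTLcard
    -- In units of `k`, the two parts together weigh at most `L (L - 3) + 2 L + 1 < L²`.
    have hsum : ∑ i ∈ TH ∪ TL j, (P.weight i + 1) < L * L * P.k := by
      rw [Finset.sum_union hdisj]
      obtain ⟨d, hd⟩ : ∃ d, L * (L - 3) = j + d :=
        ⟨_, (Nat.add_sub_of_le (Nat.le_of_lt_succ hj)).symm⟩
      have h1 : numCap L - 1 - j = d := by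
        rw [numCap]
        omega
      obtain ⟨a, rfl⟩ : ∃ a, L = a + 3 := ⟨L - 3, by omega⟩
      rw [Nat.add_sub_cancel] at hd
      rw [h1] at hTLw'
      have h2 : P.k * ((a + 3) * a) = P.k * j + P.k * d := by rw [hd, mul_add]
      nlinarith
    refine Nat.lt_of_mul_lt_mul_left (a := L * L * P.k) (hround.trans_lt ?_)
    exact Nat.mul_lt_mul_of_pos_right hsum hnum
  have hx := h _ hsub hw
  rw [Finset.sum_union hdisj, hTHx] at hx
  have h1 := Nat.mul_lt_mul_of_pos_left hx (hq0 j)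
  have h2 := hTLx j
  calc _ ≤ q j * (P.heavyMax x P.k j + P.m) + q j * ∑ i ∈ TL j, x i := by omega
    _ = q j * (P.heavyMax x P.k j + ∑ i ∈ TL j, x i + P.m) := by ring
    _ < _ := h1

variable (P)

/-! ### The dynamic program -/

/-- The base in which the numbers `p j`, `q j` are the digits of a guess. -/
def priceBase : ℕ := P.n + P.k * L + 2

/-- The number of guesses. -/
def numGuess : ℕ := P.priceBase ^ (2 * numCap L)

/-- The base in which the entries of a state are its digits. -/
def stateBase : ℕ := P.priceBase * (P.n + 1)

/-- The number of states. -/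
def numState : ℕ := P.stateBase ^ (2 * numCap L + 1)

/-- The numerator of the price for the capacity `j`. -/
def priceNum (g j : ℕ) : ℕ := digit P.priceBase g j

/-- The denominator of the price for the capacity `j`. -/
def priceDen (g j : ℕ) : ℕ := digit P.priceBase g (numCap L + j)

/-- The entry number `t` after `y` troops have been sent to the battlefield `i` in a state with the
entries `d`. Entry `0` is the number of troops, the entries `1 + j` are the values of `heavyMax`,
and the entries `numCap L + 1 + j` those of `lightExcess`. -/
def nextEntry (g : ℕ) (d : ℕ → ℕ) (i y t : ℕ) : ℕ :=
  if t = 0 then d 0 + y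
  else if t ≤ numCap L then
    if P.Heavy i ∧ P.coarse i < t then max (d t) (d (t - P.coarse i) + y) else d t
  else d t + if P.Heavy i then 0 else
    P.priceDen g (t - (numCap L + 1)) * y - P.priceNum g (t - (numCap L + 1)) * P.weight i

/-- The code of the state that follows `c`. The remainder only matters if `c` does not encode a
state or `y` exceeds the remaining budget. -/
def step (g i c y : ℕ) : ℕ :=
  encode P.stateBase (2 * numCap L + 1) (P.nextEntry g (digit P.stateBase c) i y) % P.numState

/-- The states after all battlefields in which the guessed prices certify the strategy. -/
def Accept (g c : ℕ) : Prop :=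
  ∀ j < numCap L, P.priceDen g j * (digit P.stateBase c (1 + j) + P.m) +
    P.priceNum g j * (P.k * (numCap L - 1 - j)) + digit P.stateBase c (numCap L + 1 + j) <
      P.priceDen g j * digit P.stateBase c 0

instance (g c : ℕ) : Decidable (P.Accept g c) :=
  inferInstanceAs (Decidable (∀ j < numCap L, _ < _))

/-- When `r` battlefields are left in the state `c`: zero if no continuation leads to acceptance,
and otherwise one more than a number of troops on the next battlefield with which one does. -/
def choice (g : ℕ) : ℕ → ℕ → ℕ
  | 0, c => if P.Accept g c then 1 else 0
  | r + 1, c => Nat.findGreatest (fun y => digit P.stateBase c 0 + (y - 1) ≤ P.n ∧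
      choice g r (P.step g (P.k - (r + 1)) c (y - 1)) ≠ 0) (P.n + 1)

/-- The entries of the state after the first `i` battlefields under the strategy `x`. -/
def entries (g : ℕ) (x : ℕ → ℕ) : ℕ → ℕ → ℕ
  | 0 => fun _ => 0
  | i + 1 => P.nextEntry g (entries g x i) i (x i)

/-- The code of the state after the first `i` battlefields under the strategy `x`. -/
def stateCode (g : ℕ) (x : ℕ → ℕ) (i : ℕ) : ℕ :=
  encode P.stateBase (2 * numCap L + 1) (P.entries g x i)

variable {P}

theorem entries_zero (g : ℕ) (x : ℕ → ℕ) (i : ℕ) :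
    P.entries g x i 0 = ∑ a ∈ Finset.range i, x a := by
  induction i with
  | zero => simp [entries]
  | succ i ih => simp [entries, nextEntry, ih, Finset.sum_range_succ]

theorem entries_heavy (g : ℕ) (x : ℕ → ℕ) (i : ℕ) {j : ℕ} (hj : j < numCap L) :
    P.entries g x i (1 + j) = P.heavyMax x i j := by
  induction i generalizing j with
  | zero => simp [entries, heavyMax]
  | succ i ih =>
    rw [entries, nextEntry, if_neg (by omega), if_pos (by omega), heavyMax, ih hj]
    by_cases hc : P.coarse i ≤ j
    · rw [show 1 + j - P.coarse i = 1 + (j - P.coarse i) by omega, ih (by omega)]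
      simp [hc, Nat.lt_one_add_iff]
    · simp [hc, Nat.lt_one_add_iff]

theorem entries_light (g : ℕ) (x : ℕ → ℕ) (i j : ℕ) :
    P.entries g x i (numCap L + 1 + j) = P.lightExcess (P.priceNum g j) (P.priceDen g j) x i := by
  induction i with
  | zero => simp [entries, lightExcess]
  | succ i ih =>
    rw [entries, nextEntry, if_neg (by omega), if_neg (by omega), ih, lightExcess_succ,
      Nat.add_sub_cancel_left]

theorem entries_congr (g : ℕ) {x x' : ℕ → ℕ} {i : ℕ} (h : ∀ a < i, x a = x' a) :
    P.entries g x i = P.entries g x' i := by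
  induction i with
  | zero => rfl
  | succ i ih => rw [entries, entries, ih fun a ha => h a (by omega), h i (by omega)]

theorem priceBase_pos (P : Scaled L) : 0 < P.priceBase := by
  rw [priceBase]
  omega

theorem stateBase_pos (P : Scaled L) : 0 < P.stateBase :=
  Nat.mul_pos P.priceBase_pos (Nat.succ_pos _)

theorem numState_pos (P : Scaled L) : 0 < P.numState := pow_pos P.stateBase_pos _

theorem step_lt (P : Scaled L) (g i c y : ℕ) : P.step g i c y < P.numState :=
  Nat.mod_lt _ P.numState_pos

theorem entries_lt (g : ℕ) (x : ℕ → ℕ) (i : ℕ) (hx : ∑ a ∈ Finset.range i, x a ≤ P.n) :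
    ∀ t < 2 * numCap L + 1, P.entries g x i t < P.stateBase := by
  have h1 : P.n < P.stateBase :=
    (Nat.lt_succ_self _).trans_le (Nat.le_mul_of_pos_left _ P.priceBase_pos)
  intro t ht
  rcases Nat.eq_zero_or_pos t with rfl | h0
  · rw [entries_zero]
    exact hx.trans_lt h1
  · by_cases htc : t ≤ numCap L
    · obtain ⟨j, rfl⟩ := Nat.exists_eq_add_of_le h0
      rw [Nat.succ_eq_add_one, zero_add, entries_heavy g x i (by omega)]
      exact ((P.heavyMax_le x i j).trans hx).trans_lt h1
    · obtain ⟨j, rfl⟩ := Nat.exists_eq_add_of_le (Nat.lt_of_not_ge htc)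
      rw [Nat.succ_eq_add_one, entries_light]
      have hq : P.priceDen g j < P.priceBase := Nat.mod_lt _ P.priceBase_pos
      calc _ ≤ P.priceDen g j * ∑ a ∈ Finset.range i, x a := P.lightExcess_le _ _ x i
        _ ≤ P.priceDen g j * P.n := Nat.mul_le_mul_left _ hx
        _ < P.stateBase := Nat.mul_lt_mul'' hq (Nat.lt_succ_self _)

theorem stateCode_zero (P : Scaled L) (g : ℕ) (x : ℕ → ℕ) : P.stateCode g x 0 = 0 := by
  simp [stateCode, entries, encode]

theorem stateCode_lt (g : ℕ) (x : ℕ → ℕ) (i : ℕ) (hx : ∑ a ∈ Finset.range i, x a ≤ P.n) :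
    P.stateCode g x i < P.numState :=
  encode_lt (entries_lt g x i hx)

theorem digit_stateCode (g : ℕ) (x : ℕ → ℕ) (i : ℕ) (hx : ∑ a ∈ Finset.range i, x a ≤ P.n)
    {t : ℕ} (ht : t < 2 * numCap L + 1) :
    digit P.stateBase (P.stateCode g x i) t = P.entries g x i t :=
  digit_encode (entries_lt g x i hx) ht

theorem digit_stateCode_zero (g : ℕ) (x : ℕ → ℕ) (i : ℕ)
    (hx : ∑ a ∈ Finset.range i, x a ≤ P.n) :
    digit P.stateBase (P.stateCode g x i) 0 = ∑ a ∈ Finset.range i, x a := by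
  rw [digit_stateCode g x i hx (by omega), entries_zero]

theorem nextEntry_congr (P : Scaled L) (g i y : ℕ) {d d' : ℕ → ℕ} {N : ℕ}
    (h : ∀ t < N, d t = d' t) : ∀ t < N, P.nextEntry g d i y t = P.nextEntry g d' i y t := by
  intro t ht
  rw [nextEntry, nextEntry, h t ht, h 0 (by omega), h (t - P.coarse i) (by omega)]

theorem step_stateCode (g : ℕ) (x : ℕ → ℕ) (i : ℕ)
    (hx : ∑ a ∈ Finset.range (i + 1), x a ≤ P.n) :
    P.step g i (P.stateCode g x i) (x i) = P.stateCode g x (i + 1) := by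
  have hx' : ∑ a ∈ Finset.range i, x a ≤ P.n := by
    rw [Finset.sum_range_succ] at hx
    omega
  have h : encode P.stateBase (2 * numCap L + 1)
      (P.nextEntry g (digit P.stateBase (P.stateCode g x i)) i (x i)) = P.stateCode g x (i + 1) :=
    encode_congr (P.nextEntry_congr g i (x i) fun t ht => digit_stateCode g x i hx' ht)
  rw [step, h, Nat.mod_eq_of_lt (stateCode_lt g x (i + 1) hx)]

theorem accept_stateCode_iff (g : ℕ) (x : ℕ → ℕ) (hx : ∑ a ∈ Finset.range P.k, x a ≤ P.n) :
    P.Accept g (P.stateCode g x P.k) ↔ P.Certified (P.priceNum g) (P.priceDen g) x := by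
  refine forall₂_congr fun j hj => ?_
  rw [digit_stateCode_zero g x _ hx, digit_stateCode g x _ hx (by omega),
    digit_stateCode g x _ hx (by omega), entries_heavy g x _ hj, entries_light]

theorem choice_le (P : Scaled L) (g r c : ℕ) : P.choice g r c ≤ P.n + 1 := by
  cases r with
  | zero =>
    rw [choice]
    split_ifs <;> omega
  | succ r => exact Nat.findGreatest_le _

theorem choice_succ_spec {g r c : ℕ} (h : P.choice g (r + 1) c ≠ 0) :
    digit P.stateBase c 0 + (P.choice g (r + 1) c - 1) ≤ P.n ∧
      P.choice g r (P.step g (P.k - (r + 1)) c (P.choice g (r + 1) c - 1)) ≠ 0 :=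
  Nat.findGreatest_of_ne_zero (P := fun y => digit P.stateBase c 0 + (y - 1) ≤ P.n ∧
    P.choice g r (P.step g (P.k - (r + 1)) c (y - 1)) ≠ 0) rfl h

/-- The states visited by a certified strategy all lead to acceptance. -/
theorem choice_ne_zero_of_certified {g : ℕ} {x : ℕ → ℕ}
    (hx : ∑ a ∈ Finset.range P.k, x a ≤ P.n)
    (h : P.Certified (P.priceNum g) (P.priceDen g) x) : P.choice g P.k 0 ≠ 0 := by
  have key : ∀ r ≤ P.k, P.choice g r (P.stateCode g x (P.k - r)) ≠ 0 := by
    intro r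
    induction r with
    | zero =>
      intro _
      rw [choice, Nat.sub_zero, if_pos ((accept_stateCode_iff g x hx).2 h)]
      exact one_ne_zero
    | succ r ih =>
      intro hr
      have hle (i : ℕ) (hi : i ≤ P.k) : ∑ a ∈ Finset.range i, x a ≤ P.n :=
        (Finset.sum_le_sum_of_subset (Finset.range_subset_range.2 hi)).trans hx
      have h1 := hle (P.k - (r + 1) + 1) (by omega)
      have h2 := step_stateCode g x (P.k - (r + 1)) h1
      rw [Finset.sum_range_succ] at h1
      have h3 : P.k - (r + 1) + 1 = P.k - r := by omega
      rw [choice]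
      have := Nat.le_findGreatest (P := fun y =>
        digit P.stateBase (P.stateCode g x (P.k - (r + 1))) 0 + (y - 1) ≤ P.n ∧
        P.choice g r (P.step g (P.k - (r + 1)) (P.stateCode g x (P.k - (r + 1))) (y - 1)) ≠ 0)
        (m := x (P.k - (r + 1)) + 1) (n := P.n + 1) (by omega) (by
          rw [Nat.add_sub_cancel, h2, h3, digit_stateCode_zero g x _ (hle _ (by omega))]
          exact ⟨h1, ih (by omega)⟩)
      omega
  have := key P.k le_rfl
  rwa [Nat.sub_self, stateCode_zero] at this

/-- Every pair of price vectors is encoded by a guess. -/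
theorem exists_guess (P : Scaled L) {p q : ℕ → ℕ} (hp : ∀ j, p j ≤ P.n)
    (hq : ∀ j, q j ≤ P.k * L + 1) :
    ∃ g < P.numGuess, ∀ j < numCap L, P.priceNum g j = p j ∧ P.priceDen g j = q j := by
  set f : ℕ → ℕ := fun t => if t < numCap L then p t else q (t - numCap L) with hf
  have hlt : ∀ t < 2 * numCap L, f t < P.priceBase := by
    intro t _
    have h1 := hp t
    have h2 := hq (t - numCap L)
    simp only [hf, priceBase]
    split_ifs <;> omega
  refine ⟨encode P.priceBase (2 * numCap L) f, encode_lt hlt, fun j hj => ⟨?_, ?_⟩⟩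
  · rw [priceNum, digit_encode hlt (by omega)]
    simp [hf, hj]
  · rw [priceDen, digit_encode hlt (by omega)]
    simp [hf]

/-- The dynamic program is complete: it succeeds for some guess. -/
theorem exists_choice_ne_zero (hL : 3 ≤ L) (hnum : 0 < P.num) (x : ℕ → ℕ)
    (hn : ∑ i ∈ Finset.range P.k, x i ≤ P.n)
    (h : ∀ T ⊆ Finset.range P.k, (∑ i ∈ T, P.w i) * P.den < P.num →
      ∑ i ∈ T, x i + P.m < ∑ i ∈ Finset.range P.k, x i) :
    ∃ g < P.numGuess, P.choice g P.k 0 ≠ 0 := by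
  obtain ⟨p, q, hp, hq, hc⟩ := exists_certified hL hnum x P.n hn h
  obtain ⟨g, hg, hpq⟩ := P.exists_guess hp hq
  refine ⟨g, hg, choice_ne_zero_of_certified hn fun j hj => ?_⟩
  rw [(hpq j hj).1, (hpq j hj).2]
  exact hc j hj

end Scaled

namespace Scaled

open RAM

variable {L : ℕ} (P : Scaled L)

/-! ### The expressions of the program -/

/-! Register `5` holds the guess, register `6` the number of battlefields that are left, register `7`
the code of the state, register `8` a number of troops, and register `9` a position in the table of
the values of `choice`, which is array `2`. -/

namespace Code

/-- The expression for `Scaled.weight`. -/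
def weight (L : ℕ) (i : Expr) : Expr := .const (L * L) * .reg 0 * .load 0 i * .reg 4 / .reg 3

/-- Nonzero exactly for heavy battlefields. -/
def heavy (L : ℕ) (i : Expr) : Expr := .const 1 - (.reg 0 * .const L - weight L i)

/-- The expression for `Scaled.priceBase`. -/
def priceBase (L : ℕ) : Expr := .reg 1 + .reg 0 * .const L + .const 2

/-- The expression for `Scaled.numGuess`. -/
def numGuess (L : ℕ) : Expr := .pow (priceBase L) (2 * numCap L)

/-- The expression for `Scaled.stateBase`. -/
def stateBase (L : ℕ) : Expr := priceBase L * (.reg 1 + .const 1)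

/-- The expression for `Scaled.numState`. -/
def numState (L : ℕ) : Expr := .pow (stateBase L) (2 * numCap L + 1)

/-- The expression for `digit` at a fixed position. -/
def digit (b c : Expr) (t : ℕ) : Expr := .mod (c / .pow b t) b

/-- An entry of the current state. -/
def entry (L t : ℕ) : Expr := digit (stateBase L) (.reg 7) t

/-- The expression for `Scaled.priceNum`. -/
def priceNum (L j : ℕ) : Expr := digit (priceBase L) (.reg 5) j

/-- The expression for `Scaled.priceDen`. -/
def priceDen (L j : ℕ) : Expr := digit (priceBase L) (.reg 5) (numCap L + j)

/-- The expression for `Scaled.nextEntry`. The entry `t - coarse i`, whose position depends on the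
memory, is selected by a sum over all possible positions. -/
def nextEntry (L : ℕ) (i : Expr) (t : ℕ) : Expr :=
  if t = 0 then entry L 0 + .reg 8
  else if t ≤ numCap L then
    .ite (heavy L i)
      (entry L t + (.sum (fun h =>
        .ite ((weight L i / .reg 0 - .const h) + (.const h - weight L i / .reg 0)) (.const 0)
          (entry L (t - h) + .reg 8)) t - entry L t))
      (entry L t)
  else entry L t + .ite (heavy L i) (.const 0)
    (priceDen L (t - (numCap L + 1)) * .reg 8 - priceNum L (t - (numCap L + 1)) * weight L i)

/-- The expression for `Scaled.step`, for the battlefield that is next. -/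
def step (L : ℕ) : Expr :=
  .mod (.sum (fun t => nextEntry L (.reg 0 - .reg 6) t * .pow (stateBase L) t) (2 * numCap L + 1))
    (numState L)

/-- One for accepted states and zero for the others. -/
def accept (L : ℕ) : Expr :=
  .ite (.prod (fun j => priceDen L j * entry L 0 - (priceDen L j * (entry L (1 + j) + .reg 2) +
    priceNum L j * (.reg 0 * .const (numCap L - 1 - j)) + entry L (numCap L + 1 + j))) (numCap L))
    (.const 1) (.const 0)

end Code

/-- The memory holds the instance, and all its cells hold numbers of at most `b` bits. -/
structure Holds (b : ℕ) (s : State) : Prop where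
  k : s.reg 0 = P.k
  n : s.reg 1 = P.n
  m : s.reg 2 = P.m
  num : s.reg 3 = P.num
  den : s.reg 4 = P.den
  w : s.arr 0 = P.w
  bits : s.BitsLE b

namespace Holds

variable {P} {b : ℕ} {s : State}

theorem setReg (h : P.Holds b s) {r v : ℕ} (hr : 5 ≤ r) (hv : v ≤ b) :
    P.Holds b (s.setReg r v) where
  k := by rw [State.setReg_reg, if_neg (by omega), h.k]
  n := by rw [State.setReg_reg, if_neg (by omega), h.n]
  m := by rw [State.setReg_reg, if_neg (by omega), h.m]
  num := by rw [State.setReg_reg, if_neg (by omega), h.num]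
  den := by rw [State.setReg_reg, if_neg (by omega), h.den]
  w := h.w
  bits := h.bits.setReg r (size_le_of_le hv)

theorem setArr (h : P.Holds b s) {a i v : ℕ} (ha : a ≠ 0) (hv : v ≤ b) :
    P.Holds b (s.setArr a i v) where
  k := h.k
  n := h.n
  m := h.m
  num := h.num
  den := h.den
  w := by rw [State.setArr_arr, if_neg ha.symm, h.w]
  bits := h.bits.setArr a i (size_le_of_le hv)

theorem eval_weight (h : P.Holds b s) (i : Expr) :
    (Code.weight L i).eval s = P.weight (i.eval s) := by
  simp [Code.weight, Scaled.weight, h.k, h.den, h.num, h.w]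

theorem eval_heavy (h : P.Holds b s) (i : Expr) :
    (Code.heavy L i).eval s ≠ 0 ↔ P.Heavy (i.eval s) := by
  simp only [Code.heavy, Scaled.Heavy, Expr.eval_sub, Expr.eval_const, Expr.eval_mul,
    Expr.eval_reg, h.eval_weight, h.k]
  omega

theorem eval_priceBase (h : P.Holds b s) : (Code.priceBase L).eval s = P.priceBase := by
  simp [Code.priceBase, Scaled.priceBase, h.k, h.n]

theorem eval_numGuess (h : P.Holds b s) : (Code.numGuess L).eval s = P.numGuess := by
  simp [Code.numGuess, Scaled.numGuess, h.eval_priceBase]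

theorem eval_stateBase (h : P.Holds b s) : (Code.stateBase L).eval s = P.stateBase := by
  simp [Code.stateBase, Scaled.stateBase, h.eval_priceBase, h.n]

theorem eval_numState (h : P.Holds b s) : (Code.numState L).eval s = P.numState := by
  simp [Code.numState, Scaled.numState, h.eval_stateBase]

theorem eval_entry (h : P.Holds b s) (t : ℕ) :
    (Code.entry L t).eval s = digit P.stateBase (s.reg 7) t := by
  simp [Code.entry, Code.digit, digit, h.eval_stateBase]

theorem eval_priceNum (h : P.Holds b s) (j : ℕ) :
    (Code.priceNum L j).eval s = P.priceNum (s.reg 5) j := by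
  simp [Code.priceNum, Code.digit, Scaled.priceNum, digit, h.eval_priceBase]

theorem eval_priceDen (h : P.Holds b s) (j : ℕ) :
    (Code.priceDen L j).eval s = P.priceDen (s.reg 5) j := by
  simp [Code.priceDen, Code.digit, Scaled.priceDen, digit, h.eval_priceBase]

theorem eval_nextEntry (h : P.Holds b s) (i : Expr) (t : ℕ) :
    (Code.nextEntry L i t).eval s =
      P.nextEntry (s.reg 5) (digit P.stateBase (s.reg 7)) (i.eval s) (s.reg 8) t := by
  have hsel (a : ℕ) (f : ℕ → ℕ) :
      ∑ x ∈ Finset.range t, (if a - x + (x - a) ≠ 0 then 0 else f x) =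
        if a < t then f a else 0 := by
    have he := Finset.sum_ite_eq (Finset.range t) a f
    simp only [Finset.mem_range] at he
    rw [← he]
    refine Finset.sum_congr rfl fun x _ => ?_
    by_cases hx : a = x
    · simp [hx]
    · rw [if_pos (by omega), if_neg hx]
  rw [Code.nextEntry, Scaled.nextEntry]
  split_ifs with h0 ht hc hc
  · simp [h.eval_entry]
  · rw [Expr.eval_ite, if_pos ((h.eval_heavy i).2 hc.1)]
    simp only [Expr.eval_add, Expr.eval_sub, Expr.eval_sum, Expr.eval_ite, Expr.eval_const,
      Expr.eval_div, Expr.eval_reg, h.eval_entry, h.eval_weight, h.k]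
    rw [hsel, ← Scaled.coarse, if_pos hc.2]
    omega
  · rw [Expr.eval_ite]
    split_ifs with hh
    · have hc' : ¬ P.coarse (i.eval s) < t := fun h' => hc ⟨(h.eval_heavy i).1 hh, h'⟩
      simp only [Expr.eval_add, Expr.eval_sub, Expr.eval_sum, Expr.eval_ite, Expr.eval_const,
        Expr.eval_div, Expr.eval_reg, h.eval_entry, h.eval_weight, h.k]
      rw [hsel, ← Scaled.coarse, if_neg hc']
      omega
    · exact h.eval_entry t
  · rw [Expr.eval_add, Expr.eval_ite, if_pos ((h.eval_heavy i).2 hc), h.eval_entry,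
      Expr.eval_const]
  · rw [Expr.eval_add, Expr.eval_ite, if_neg (mt (h.eval_heavy i).1 hc), h.eval_entry]
    simp [h.eval_priceDen, h.eval_priceNum, h.eval_weight]

theorem eval_step (h : P.Holds b s) :
    (Code.step L).eval s = P.step (s.reg 5) (P.k - s.reg 6) (s.reg 7) (s.reg 8) := by
  simp [Code.step, Scaled.step, encode, h.eval_nextEntry, h.eval_stateBase, h.eval_numState, h.k]

theorem eval_accept (h : P.Holds b s) :
    (Code.accept L).eval s = P.choice (s.reg 5) 0 (s.reg 7) := by
  rw [Code.accept, Expr.eval_ite, Expr.eval_prod, Scaled.choice]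
  refine if_congr ?_ rfl rfl
  rw [Finset.prod_ne_zero_iff]
  simp only [Expr.eval_add, Expr.eval_sub, Expr.eval_mul, Expr.eval_const, Expr.eval_reg,
    h.eval_entry, h.eval_priceNum, h.eval_priceDen, h.k, h.m, Finset.mem_range, Scaled.Accept,
    Nat.sub_ne_zero_iff_lt]

end Holds

end Scaled

namespace Scaled

open RAM

/-! ### The program -/

namespace Code

/-- One round of the search for the troops on the next battlefield: if the state reached with the
troops in register `8` is within the budget and leads to acceptance, they are entered in the
table. -/
def tryTroops (L : ℕ) : Prog :=
  .seq (.cond (.load 2 ((.reg 6 - .const 1) * numState L + step L) *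
      (.reg 1 + .const 1 - (entry L 0 + .reg 8)))
    (.store 2 (.reg 9) (.reg 8 + .const 1)) .nop)
  (.assign 8 (.reg 8 + .const 1))

/-- Computes the table entry at the position in register `9`. -/
def fillEntry (L : ℕ) : Prog :=
  .seq (.assign 6 (.reg 9 / numState L)) <|
  .seq (.assign 7 (.mod (.reg 9) (numState L))) <|
  .seq (.cond (.reg 6)
    (.seq (.store 2 (.reg 9) (.const 0)) <|
      .seq (.assign 8 (.const 0)) <|
      .loop (.reg 1 + .const 1 - .reg 8) (tryTroops L))
    (.store 2 (.reg 9) (accept L)))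
  (.assign 9 (.reg 9 + .const 1))

/-- Computes the table for the guess in register `5`. -/
def fill (L : ℕ) : Prog :=
  .seq (.assign 9 (.const 0)) <|
  .loop ((.reg 0 + .const 1) * numState L - .reg 9) (fillEntry L)

/-- Outputs the troops on the next battlefield according to the table. -/
def traceStep (L : ℕ) : Prog :=
  .seq (.assign 8 (.load 2 (.reg 6 * numState L + .reg 7) - .const 1)) <|
  .seq (.store 1 (.reg 0 - .reg 6) (.reg 8)) <|
  .seq (.assign 7 (step L)) <|
  .assign 6 (.reg 6 - .const 1)

/-- Outputs the strategy found in the table. -/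
def trace (L : ℕ) : Prog :=
  .seq (.assign 7 (.const 0)) <|
  .seq (.assign 6 (.reg 0)) <|
  .loop (.reg 6) (traceStep L)

/-- The algorithm: for every guess, fill the table and output a strategy if there is one. -/
def main (L : ℕ) : Prog :=
  .seq (.assign 5 (.const 0)) <|
  .loop (numGuess L - .reg 5) <|
    .seq (fill L) <|
    .seq (.cond (.load 2 (.reg 0 * numState L)) (trace L) .nop) <|
    .assign 5 (.reg 5 + .const 1)

end Code

variable {L : ℕ} (P : Scaled L)

/-- The contents of the table: row `r` holds the values of `choice` for `r` battlefields left. -/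
def table (g t : ℕ) : ℕ := P.choice g (t / P.numState) (t % P.numState)

variable {P} {b τ : ℕ}

theorem table_row (P : Scaled L) (g r : ℕ) {c : ℕ} (hc : c < P.numState) :
    P.table g (r * P.numState + c) = P.choice g r c := by
  rw [table, mul_comm, Nat.mul_add_div P.numState_pos, Nat.div_eq_of_lt hc, add_zero,
    Nat.mul_add_mod, Nat.mod_eq_of_lt hc]

/-- All positions of a row of the table precede those of the later rows. -/
theorem row_lt (P : Scaled L) {r r' c : ℕ} (hr : r < r') (hc : c < P.numState) :
    r * P.numState + c < r' * P.numState := by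
  have := Nat.mul_le_mul_right P.numState (Nat.succ_le_of_lt hr)
  rw [Nat.succ_mul] at this
  omega

/-- After the numbers of troops below `y` have been tried, the table entry is the value of
`Nat.findGreatest` up to `y`, because troops are entered with one added. -/
theorem runs_tryTroops (hτ : ∀ s, P.Holds b s → ∀ e ∈ (Code.main L).exprs, e.cost s ≤ τ)
    (hb : P.n + 2 ≤ b) {g r c t y : ℕ} {o : ℕ → ℕ} (hr : t / P.numState = r + 1)
    (hy : y < P.n + 1) {s : State}
    (h : P.Holds b s) (h5 : s.reg 5 = g) (h6 : s.reg 6 = r + 1) (h7 : s.reg 7 = c)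
    (h8 : s.reg 8 = y) (h9 : s.reg 9 = t) (h1 : s.arr 1 = o)
    (h2 : ∀ t' < t, s.arr 2 t' = P.table g t')
    (ht : s.arr 2 t = Nat.findGreatest (fun y => digit P.stateBase c 0 + (y - 1) ≤ P.n ∧
      P.choice g r (P.step g (P.k - (r + 1)) c (y - 1)) ≠ 0) y) :
    Runs (Code.tryTroops L) s (τ + 1 + (2 * τ + 1) + (τ + 1)) fun s' => P.Holds b s' ∧
      s'.reg 5 = g ∧ s'.reg 6 = r + 1 ∧ s'.reg 7 = c ∧ s'.reg 8 = y + 1 ∧ s'.reg 9 = t ∧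
      s'.arr 1 = o ∧ (∀ t' < t, s'.arr 2 t' = P.table g t') ∧
      s'.arr 2 t = Nat.findGreatest (fun y => digit P.stateBase c 0 + (y - 1) ≤ P.n ∧
        P.choice g r (P.step g (P.k - (r + 1)) c (y - 1)) ≠ 0) (y + 1) := by
  have hpos : r * P.numState + P.step g (P.k - (r + 1)) c y < t :=
    (P.row_lt (Nat.lt_succ_self r) (P.step_lt _ _ _ _)).trans_le
      (by rw [Nat.succ_eq_add_one, ← hr]; exact Nat.div_mul_le_self _ _)
  have hcond : (Expr.load 2 ((.reg 6 - .const 1) * Code.numState L + Code.step L) *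
      (.reg 1 + .const 1 - (Code.entry L 0 + .reg 8))).eval s ≠ 0 ↔
      digit P.stateBase c 0 + (y + 1 - 1) ≤ P.n ∧
        P.choice g r (P.step g (P.k - (r + 1)) c (y + 1 - 1)) ≠ 0 := by
    simp only [Expr.eval_mul, Expr.eval_load, Expr.eval_add, Expr.eval_sub, Expr.eval_reg,
      Expr.eval_const, h.eval_numState, h.eval_step, h.eval_entry, h.n, h5, h6, h7, h8,
      Nat.add_sub_cancel, h2 _ hpos, P.table_row g r (P.step_lt _ _ _ _)]
    rw [Nat.mul_ne_zero_iff, Nat.sub_ne_zero_iff_lt, Nat.lt_succ_iff, and_comm]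
  refine .seq (Q := fun s' => P.Holds b s' ∧ s'.reg = s.reg ∧ s'.arr 1 = o ∧
    (∀ t' < t, s'.arr 2 t' = P.table g t') ∧
    s'.arr 2 t = Nat.findGreatest (fun y => digit P.stateBase c 0 + (y - 1) ≤ P.n ∧
      P.choice g r (P.step g (P.k - (r + 1)) c (y - 1)) ≠ 0) (y + 1))
    (.cond (hτ s h _ ?_) (fun hc => .store (hτ s h _ ?_) (hτ s h _ ?_) ?_)
      (fun hc => (Runs.nop ?_).mono (by omega) fun _ h => h)) ?_
  · simp [Code.main, Code.fill, Code.fillEntry, Code.tryTroops, Prog.exprs]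
  · simp [Code.main, Code.fill, Code.fillEntry, Code.tryTroops, Prog.exprs]
  · simp [Code.main, Code.fill, Code.fillEntry, Code.tryTroops, Prog.exprs]
  · have h8' : (Expr.reg 8 + .const 1).eval s = y + 1 := by simp [h8]
    rw [h8', Expr.eval_reg, h9]
    refine ⟨h.setArr (by omega) (by omega), rfl, by simpa using h1, fun t' ht' => ?_, ?_⟩
    · simpa [Function.update_of_ne ht'.ne] using h2 t' ht'
    · rw [Nat.findGreatest_succ, if_pos (hcond.1 hc)]
      simp
  · refine ⟨h, rfl, h1, h2, ?_⟩
    rw [Nat.findGreatest_succ, if_neg (fun h' => hcond.2 h' hc), ht]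
  · rintro s' ⟨h', hreg, h1', h2', ht'⟩
    have h8' : (Expr.reg 8 + .const 1).eval s' = y + 1 := by simp [hreg, h8]
    refine .assign (hτ s' h' _ ?_) ?_
    · simp [Code.main, Code.fill, Code.fillEntry, Code.tryTroops, Prog.exprs]
    · rw [h8']
      refine ⟨h'.setReg (by omega) (by omega), ?_, ?_, ?_, ?_, ?_, h1', h2', ht'⟩ <;>
        simp [*]

theorem runs_fillEntry (hτ : ∀ s, P.Holds b s → ∀ e ∈ (Code.main L).exprs, e.cost s ≤ τ)
    (hb : P.n + 2 ≤ b) {g t : ℕ} {o : ℕ → ℕ} (hbt : t + 1 ≤ b) {s : State}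
    (h : P.Holds b s) (h5 : s.reg 5 = g) (h9 : s.reg 9 = t) (h1 : s.arr 1 = o)
    (h2 : ∀ t' < t, s.arr 2 t' = P.table g t') :
    Runs (Code.fillEntry L) s ((P.n + 4) * (5 * τ + 4)) fun s' => P.Holds b s' ∧
      s'.reg 5 = g ∧ s'.reg 9 = t + 1 ∧ s'.arr 1 = o ∧
      ∀ t' < t + 1, s'.arr 2 t' = P.table g t' := by
  have hSt : t / P.numState ≤ t := Nat.div_le_self _ _
  have hst : t % P.numState ≤ t := Nat.mod_le _ _
  have e6 : (Expr.reg 9 / Code.numState L).eval s = t / P.numState := by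
    simp [h.eval_numState, h9]
  refine Runs.mono (.assign_seq (T := τ + 1 + ((τ + 1 + (2 * τ + 1 + (τ + 1 +
    ((P.n + 1) * (τ + 1 + (τ + 1 + (2 * τ + 1) + (τ + 1))) + (τ + 1))))) + (τ + 1)))
    (hτ s h _ ?_) ?_) ?_ fun _ h => h
  · simp [Code.main, Code.fill, Code.fillEntry, Prog.exprs]
  swap
  · ring_nf
    omega
  rw [e6]
  have hA := h.setReg (r := 6) (by omega) (hSt.trans (by omega))
  have e7 : (Expr.mod (.reg 9) (Code.numState L)).eval (s.setReg 6 (t / P.numState)) =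
      t % P.numState := by simp [hA.eval_numState, h9]
  refine .assign_seq (hτ _ hA _ ?_) ?_
  · simp [Code.main, Code.fill, Code.fillEntry, Prog.exprs]
  rw [e7]
  have hB := hA.setReg (r := 7) (by omega) (hst.trans (by omega))
  set s₁ := (s.setReg 6 (t / P.numState)).setReg 7 (t % P.numState) with hs₁
  refine .seq (Q := fun s' => P.Holds b s' ∧ s'.reg 5 = g ∧ s'.reg 9 = t ∧ s'.arr 1 = o ∧
    (∀ t' < t, s'.arr 2 t' = P.table g t') ∧ s'.arr 2 t = P.table g t)
    (.cond (hτ _ hB _ ?_) (fun hc => ?_)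
      (fun hc => .mono (.store (hτ _ hB _ ?_) (hτ _ hB _ ?_) ?_) (by omega) fun _ h => h)) ?_
  · simp [Code.main, Code.fill, Code.fillEntry, Prog.exprs]
  · have hc' : t / P.numState ≠ 0 := by simpa [hs₁] using hc
    obtain ⟨r, hr⟩ := Nat.exists_eq_succ_of_ne_zero hc'
    refine .store_seq (hτ _ hB _ ?_) (hτ _ hB _ ?_) ?_
    · simp [Code.main, Code.fill, Code.fillEntry, Prog.exprs]
    · simp [Code.main, Code.fill, Code.fillEntry, Prog.exprs]
    have e9 : (Expr.reg 9).eval s₁ = t := by simp [hs₁, h9]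
    rw [e9, Expr.eval_const]
    have hC := hB.setArr (a := 2) (i := t) (v := 0) (by omega) (by omega)
    refine .assign_seq (hτ _ hC _ ?_) ?_
    · simp [Code.main, Code.fill, Code.fillEntry, Prog.exprs]
    rw [Expr.eval_const]
    have hD := hC.setReg (r := 8) (v := 0) (by omega) (by omega)
    refine Runs.mono (.loop (fun y s' => P.Holds b s' ∧
      s'.reg 5 = g ∧ s'.reg 6 = r + 1 ∧ s'.reg 7 = t % P.numState ∧ s'.reg 8 = y ∧
      s'.reg 9 = t ∧ s'.arr 1 = o ∧ (∀ t' < t, s'.arr 2 t' = P.table g t') ∧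
      s'.arr 2 t = Nat.findGreatest (fun y =>
        digit P.stateBase (t % P.numState) 0 + (y - 1) ≤ P.n ∧
        P.choice g r (P.step g (P.k - (r + 1)) (t % P.numState) (y - 1)) ≠ 0) y) (P.n + 1)
      ?_ ?_ ?_) le_rfl ?_
    · rintro y s' hy ⟨h', -, -, -, h8', -⟩
      refine ⟨hτ _ h' _ ?_, ?_⟩
      · simp [Code.main, Code.fill, Code.fillEntry, Prog.exprs]
      · simp only [Expr.eval_sub, Expr.eval_add, Expr.eval_reg, Expr.eval_const, h'.n, h8']
        omega
    · rintro y s' hy ⟨h', h5', h6', h7', h8', h9', h1', h2', ht'⟩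
      exact runs_tryTroops hτ hb hr hy h' h5' h6' h7' h8' h9' h1' h2' ht'
    · refine ⟨hD, ?_, ?_, ?_, ?_, ?_, ?_, fun t' ht' => ?_, ?_⟩
      · simpa [hs₁] using h5
      · simpa [hs₁] using hr
      · simp [hs₁]
      · simp
      · simpa [hs₁] using h9
      · simpa [hs₁] using h1
      · simpa [hs₁, Function.update_of_ne ht'.ne] using h2 t' ht'
      · simp
    · rintro s' ⟨h', h5', -, -, -, h9', h1', h2', ht'⟩
      refine ⟨h', h5', h9', h1', h2', ?_⟩
      rw [ht', table, hr, Nat.succ_eq_add_one, choice]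
  · simp [Code.main, Code.fill, Code.fillEntry, Prog.exprs]
  · simp [Code.main, Code.fill, Code.fillEntry, Prog.exprs]
  · have e9 : (Expr.reg 9).eval s₁ = t := by simp [hs₁, h9]
    have hc' : t / P.numState = 0 := by simpa [hs₁] using hc
    have eA : (Code.accept L).eval s₁ = P.table g t := by
      rw [hB.eval_accept, table, hc']
      simp [hs₁, h5]
    rw [e9, eA]
    refine ⟨hB.setArr (by omega) ((P.choice_le _ _ _).trans (by omega)), ?_, ?_, ?_,
      fun t' ht' => ?_, ?_⟩
    · simpa [hs₁] using h5
    · simpa [hs₁] using h9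
    · simpa [hs₁] using h1
    · simpa [hs₁, Function.update_of_ne ht'.ne] using h2 t' ht'
    · simp
  · rintro s' ⟨h', h5', h9', h1', h2', ht'⟩
    have e9 : (Expr.reg 9 + .const 1).eval s' = t + 1 := by simp [h9']
    refine .assign (hτ _ h' _ ?_) ?_
    · simp [Code.main, Code.fill, Code.fillEntry, Prog.exprs]
    rw [e9]
    refine ⟨h'.setReg (by omega) hbt, by simpa using h5', by simp, h1', fun t' hlt => ?_⟩
    rcases Nat.lt_succ_iff_lt_or_eq.1 hlt with hlt | rfl
    exacts [h2' t' hlt, ht']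

theorem runs_fill (hτ : ∀ s, P.Holds b s → ∀ e ∈ (Code.main L).exprs, e.cost s ≤ τ)
    (hb : P.n + 2 ≤ b) (hbS : (P.k + 1) * P.numState ≤ b) {g : ℕ} {o : ℕ → ℕ} {s : State}
    (h : P.Holds b s) (h5 : s.reg 5 = g) (h1 : s.arr 1 = o) :
    Runs (Code.fill L) s (τ + 1 + ((P.k + 1) * P.numState *
      (τ + 1 + (P.n + 4) * (5 * τ + 4)) + (τ + 1))) fun s' => P.Holds b s' ∧
      s'.reg 5 = g ∧ s'.arr 1 = o ∧
      ∀ t < (P.k + 1) * P.numState, s'.arr 2 t = P.table g t := by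
  refine .assign_seq (hτ _ h _ ?_) ?_
  · simp [Code.main, Code.fill, Prog.exprs]
  rw [Expr.eval_const]
  refine .mono (.loop (fun t s' => P.Holds b s' ∧ s'.reg 5 = g ∧ s'.reg 9 = t ∧ s'.arr 1 = o ∧
    ∀ t' < t, s'.arr 2 t' = P.table g t') _ ?_ ?_ ?_) le_rfl
    fun s' ⟨h', h5', _, h1', h2'⟩ => ⟨h', h5', h1', h2'⟩
  · rintro t s' ht ⟨h', -, h9', -⟩
    refine ⟨hτ _ h' _ ?_, ?_⟩
    · simp [Code.main, Code.fill, Prog.exprs]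
    · simp only [Expr.eval_sub, Expr.eval_mul, Expr.eval_add, Expr.eval_reg, Expr.eval_const,
        h'.k, h'.eval_numState, h9']
      omega
  · rintro t s' ht ⟨h', h5', h9', h1', h2'⟩
    exact runs_fillEntry hτ hb (by omega) h' h5' h9' h1' h2'
  · exact ⟨h.setReg (by omega) (by omega), by simpa using h5, by simp, h1, by simp⟩

/-- The invariant is that the output so far leads to the state in register `7`, from which the table
promises acceptance. -/
theorem runs_trace (hτ : ∀ s, P.Holds b s → ∀ e ∈ (Code.main L).exprs, e.cost s ≤ τ)
    (hb : P.n + 2 ≤ b) (hbk : P.k ≤ b) (hbS : P.numState ≤ b) {g : ℕ} {s : State}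
    (h : P.Holds b s) (h5 : s.reg 5 = g)
    (h2 : ∀ t < (P.k + 1) * P.numState, s.arr 2 t = P.table g t)
    (hg : P.choice g P.k 0 ≠ 0) :
    Runs (Code.trace L) s (τ + 1 + (τ + 1 + (P.k * (τ + 1 + (5 * τ + 4)) + (τ + 1))))
      fun s' => P.Holds b s' ∧ s'.reg 5 = g ∧ ∑ i ∈ Finset.range P.k, s'.arr 1 i ≤ P.n ∧
        P.Certified (P.priceNum g) (P.priceDen g) (s'.arr 1) := by
  refine .assign_seq (hτ _ h _ ?_) ?_
  · simp [Code.main, Code.trace, Prog.exprs]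
  rw [Expr.eval_const]
  have hA := h.setReg (r := 7) (v := 0) (by omega) (by omega)
  refine .assign_seq (hτ _ hA _ ?_) ?_
  · simp [Code.main, Code.trace, Prog.exprs]
  rw [Expr.eval_reg, hA.k]
  refine .mono (.loop (fun i s' => P.Holds b s' ∧ s'.reg 5 = g ∧ s'.reg 6 = P.k - i ∧
    s'.reg 7 = P.stateCode g (s'.arr 1) i ∧ ∑ a ∈ Finset.range i, s'.arr 1 a ≤ P.n ∧
    (∀ t < (P.k + 1) * P.numState, s'.arr 2 t = P.table g t) ∧
    P.choice g (P.k - i) (P.stateCode g (s'.arr 1) i) ≠ 0) P.k ?_ ?_ ?_) le_rfl ?_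
  · rintro i s' hi ⟨h', -, h6', -⟩
    refine ⟨hτ _ h' _ ?_, ?_⟩
    · simp [Code.main, Code.trace, Prog.exprs]
    · rw [Expr.eval_reg, h6']
      omega
  · rintro i s' hi ⟨h', h5', h6', h7', hsum, h2', hc⟩
    obtain ⟨r, hr⟩ : ∃ r, P.k - i = r + 1 := ⟨P.k - i - 1, by omega⟩
    have hi' : P.k - (r + 1) = i := by omega
    rw [hr] at hc h6'
    set x := s'.arr 1 with hx
    set c := P.stateCode g x i with hcdef
    have hclt : c < P.numState := stateCode_lt g x i hsum
    set y := P.choice g (r + 1) c - 1 with hy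
    have hspec := choice_succ_spec hc
    rw [← hy, hi', digit_stateCode_zero g x i hsum] at hspec
    have e8 : (Expr.load 2 (.reg 6 * Code.numState L + .reg 7) - .const 1).eval s' = y := by
      simp only [Expr.eval_sub, Expr.eval_load, Expr.eval_add, Expr.eval_mul, Expr.eval_reg,
        Expr.eval_const, h'.eval_numState, h6', h7']
      rw [h2' _ (P.row_lt (by omega) hclt), P.table_row g _ hclt]
    have hyn : y ≤ P.n := by omega
    refine .mono (.assign_seq (hτ _ h' _ ?_) (.store_seq (T := τ + 1 + (τ + 1)) ?_ ?_ ?_))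
      (T := τ + 1 + (2 * τ + 1 + (τ + 1 + (τ + 1)))) (by omega) fun _ h => h
    · simp [Code.main, Code.trace, Code.traceStep, Prog.exprs]
    · rw [e8]
      refine hτ _ (h'.setReg (by omega) (by omega)) _ ?_
      simp [Code.main, Code.trace, Code.traceStep, Prog.exprs]
    · rw [e8]
      refine hτ _ (h'.setReg (by omega) (by omega)) _ ?_
      simp [Code.main, Code.trace, Code.traceStep, Prog.exprs]
    rw [e8]
    have hB := h'.setReg (r := 8) (v := y) (by omega) (by omega)
    have e1 : (Expr.reg 0 - .reg 6).eval (s'.setReg 8 y) = i := by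
      rw [Expr.eval_sub, Expr.eval_reg, hB.k]
      simp only [Expr.eval_reg, State.setReg_reg]
      simp only [Nat.reduceEqDiff, if_false, h6']
      exact hi'
    have e1' : (Expr.reg 8).eval (s'.setReg 8 y) = y := by simp
    rw [e1, e1']
    have hC := hB.setArr (a := 1) (i := i) (v := y) (by omega) (by omega)
    set s₁ := (s'.setReg 8 y).setArr 1 i y with hs₁
    have hx₁ : s₁.arr 1 = Function.update x i y := by simp [hs₁, hx]
    have hsame : ∀ a < i, x a = Function.update x i y a := fun a ha => by
      rw [Function.update_of_ne ha.ne]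
    have hcode : P.stateCode g (Function.update x i y) i = c := by
      rw [hcdef, stateCode, stateCode, entries_congr g hsame]
    have hsum' : ∑ a ∈ Finset.range (i + 1), Function.update x i y a ≤ P.n := by
      rw [Finset.sum_range_succ, Function.update_self,
        ← Finset.sum_congr rfl fun a ha => hsame a (Finset.mem_range.1 ha)]
      exact hspec.1
    have hstep := step_stateCode g _ i hsum'
    rw [hcode, Function.update_self] at hstep
    have e7 : (Code.step L).eval s₁ = P.stateCode g (Function.update x i y) (i + 1) := by
      rw [hC.eval_step, ← hstep]
      simp [hs₁, h5', h6', h7', hi']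
    refine .assign_seq (hτ _ hC _ ?_) ?_
    · simp [Code.main, Code.trace, Code.traceStep, Prog.exprs]
    rw [e7]
    have hlt := stateCode_lt g _ _ hsum'
    have hD := hC.setReg (r := 7) (v := P.stateCode g (Function.update x i y) (i + 1))
      (by omega) (by omega)
    refine .assign (hτ _ hD _ ?_) ?_
    · simp [Code.main, Code.trace, Code.traceStep, Prog.exprs]
    have e6 : (Expr.reg 6 - .const 1).eval
        (s₁.setReg 7 (P.stateCode g (Function.update x i y) (i + 1))) = r := by
      simp [hs₁, h6']
    rw [e6]
    refine ⟨hD.setReg (by omega) (by omega), ?_, ?_, ?_, ?_, ?_, ?_⟩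
    · simpa [hs₁] using h5'
    · rw [State.setReg_reg, if_pos rfl]
      omega
    · simp [hx₁]
    · simpa [hx₁] using hsum'
    · simpa [hs₁] using h2'
    · rw [show P.k - (i + 1) = r by omega]
      simpa [hx₁, ← hstep] using hspec.2
  · refine ⟨hA.setReg (by omega) hbk, by simpa using h5, by simp, ?_, by simp, by simpa using h2, ?_⟩
    · rw [stateCode_zero]
      simp
    · rw [stateCode_zero]
      exact hg
  · rintro s' ⟨h', h5', -, -, hsum, -, hc⟩
    refine ⟨h', h5', hsum, (accept_stateCode_iff g _ hsum).1 ?_⟩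
    rw [Nat.sub_self, choice] at hc
    by_contra hacc
    exact hc (if_neg hacc)

/-- A bound on the running time of the program, when the evaluation of an expression takes time at
most `τ`. -/
def timeBound (τ k n S G : ℕ) : ℕ :=
  τ + 1 + (G * (τ + 1 + (τ + 1 + ((k + 1) * S * (τ + 1 + (n + 4) * (5 * τ + 4)) + (τ + 1)) +
    (τ + 1 + (τ + 1 + (τ + 1 + (k * (τ + 1 + (5 * τ + 4)) + (τ + 1)))) + (τ + 1)))) + (τ + 1))

/-- The algorithm finds a certified strategy if the dynamic program succeeds for some guess, and
outputs zeros otherwise. -/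
theorem runs_main (hτ : ∀ s, P.Holds b s → ∀ e ∈ (Code.main L).exprs, e.cost s ≤ τ)
    (hb : P.n + 2 ≤ b) (hbS : (P.k + 1) * P.numState ≤ b) (hbk : P.k ≤ b)
    (hbG : P.numGuess ≤ b) {s : State} (h : P.Holds b s) (h1 : s.arr 1 = fun _ => 0) :
    Runs (Code.main L) s (timeBound τ P.k P.n P.numState P.numGuess) fun s' =>
      (s'.arr 1 = fun _ => 0) ∧ (∀ g < P.numGuess, P.choice g P.k 0 = 0) ∨
      ∑ i ∈ Finset.range P.k, s'.arr 1 i ≤ P.n ∧ ∃ p q, P.Certified p q (s'.arr 1) := by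
  have hSb : P.numState ≤ b := (Nat.le_mul_of_pos_left _ (Nat.succ_pos _)).trans hbS
  refine .assign_seq (hτ _ h _ ?_) ?_
  · simp [Code.main, Prog.exprs]
  rw [Expr.eval_const]
  refine .mono (.loop (fun g s' => P.Holds b s' ∧ s'.reg 5 = g ∧
    ((s'.arr 1 = fun _ => 0) ∧ (∀ g' < g, P.choice g' P.k 0 = 0) ∨
      ∑ i ∈ Finset.range P.k, s'.arr 1 i ≤ P.n ∧ ∃ p q, P.Certified p q (s'.arr 1)))
    P.numGuess ?_ ?_ ?_) le_rfl fun s' h' => h'.2.2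
  · rintro g s' hg ⟨h', h5', -⟩
    refine ⟨hτ _ h' _ ?_, ?_⟩
    · simp [Code.main, Prog.exprs]
    · rw [Expr.eval_sub, Expr.eval_reg, h'.eval_numGuess, h5']
      omega
  · rintro g s' hg ⟨h', h5', hout⟩
    refine .seq (runs_fill hτ hb hbS h' h5' rfl) ?_
    rintro s₁ ⟨h₁, h5₁, h1₁, h2₁⟩
    have hload : (Expr.load 2 (.reg 0 * Code.numState L)).eval s₁ = P.choice g P.k 0 := by
      simp only [Expr.eval_load, Expr.eval_mul, Expr.eval_reg, h₁.k, h₁.eval_numState]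
      rw [← P.table_row g P.k P.numState_pos, add_zero]
      exact h2₁ _ (P.row_lt (Nat.lt_succ_self _) P.numState_pos)
    refine .seq (Q := fun s₂ => P.Holds b s₂ ∧ s₂.reg 5 = g ∧
      ((s₂.arr 1 = fun _ => 0) ∧ (∀ g' < g + 1, P.choice g' P.k 0 = 0) ∨
        ∑ i ∈ Finset.range P.k, s₂.arr 1 i ≤ P.n ∧ ∃ p q, P.Certified p q (s₂.arr 1)))
      (.cond (hτ _ h₁ _ ?_) (fun hc => ?_) (fun hc => .mono (.nop ?_) (by omega) fun _ h => h)) ?_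
    · simp [Code.main, Prog.exprs]
    · exact (runs_trace hτ hb hbk hSb h₁ h5₁ h2₁ (hload ▸ hc)).mono le_rfl
        fun s₂ ⟨h₂, h5₂, hsum, hcert⟩ => ⟨h₂, h5₂, .inr ⟨hsum, _, _, hcert⟩⟩
    · refine ⟨h₁, h5₁, ?_⟩
      rw [h1₁]
      refine hout.imp_left fun ⟨h0, hno⟩ => ⟨h0, fun g' hg' => ?_⟩
      rcases Nat.lt_succ_iff_lt_or_eq.1 hg' with hlt | rfl
      exacts [hno g' hlt, hload ▸ hc]
    · rintro s₂ ⟨h₂, h5₂, hout₂⟩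
      have e5 : (Expr.reg 5 + .const 1).eval s₂ = g + 1 := by simp [h5₂]
      refine .assign (hτ _ h₂ _ ?_) ?_
      · simp [Code.main, Prog.exprs]
      rw [e5]
      exact ⟨h₂.setReg (by omega) (by omega), by simp, hout₂⟩
  · exact ⟨h.setReg (by omega) (by omega), by simp, .inl ⟨h1, by simp⟩⟩

end Scaled

/-! ### The algorithm on Blotto instances -/

namespace Blotto

/-- The numerical data of an instance and a target utility. -/
def scaled (L : ℕ) (G : Blotto) (u : ℚ≥0) : Scaled L where
  k := G.k
  n := G.n
  m := G.m
  num := u.num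
  den := u.den
  w := (G.input u).arr 0

theorem input_arr_zero (G : Blotto) (u : ℚ≥0) (i : Fin G.k) : (G.input u).arr 0 i = G.w i := by
  simp [input]

/-- Weights are positive, so each battlefield contributes to the length of the input. -/
theorem k_le_inputSize (G : Blotto) (u : ℚ≥0) : G.k ≤ G.inputSize u := by
  have h : ∑ _i : Fin G.k, 1 ≤ ∑ i, (G.w i).size :=
    Finset.sum_le_sum fun i _ => Nat.size_pos.2 (G.w_pos i)
  rw [Finset.sum_const, Finset.card_univ, Fintype.card_fin, smul_eq_mul, mul_one] at h
  unfold inputSize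
  omega

theorem bitsLE_input (G : Blotto) (u : ℚ≥0) : (G.input u).BitsLE (G.inputSize u) := by
  have hk := RAM.size_le_of_le (G.k_le_inputSize u)
  have hn : G.n.size ≤ G.inputSize u :=
    RAM.size_le_of_le (by unfold inputSize; omega)
  have hm : G.m.size ≤ G.inputSize u :=
    RAM.size_le_of_le (by unfold inputSize; omega)
  constructor
  · intro r
    unfold input
    dsimp only
    split
    · exact hk
    · exact hn
    · exact hm
    · unfold inputSize
      omega
    · unfold inputSize
      omega
    · simp
  · intro a i
    unfold input
    dsimp only
    split_ifs with h
    · have := Finset.single_le_sum (f := fun i => (G.w i).size) (fun _ _ => Nat.zero_le _)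
        (Finset.mem_univ (⟨i, h.2⟩ : Fin G.k))
      unfold inputSize
      omega
    · simp

theorem holds_input (L : ℕ) (G : Blotto) (u : ℚ≥0) {b : ℕ} (hb : G.inputSize u ≤ b) :
    (G.scaled L u).Holds b (G.input u) where
  k := rfl
  n := rfl
  m := rfl
  num := rfl
  den := rfl
  w := rfl
  bits := ⟨fun r => ((G.bitsLE_input u).1 r).trans hb,
    fun a i => ((G.bitsLE_input u).2 a i).trans hb⟩

theorem sum_fin_eq_sum_map {k : ℕ} (T : Finset (Fin k)) (f : ℕ → ℕ) :
    ∑ i ∈ T, f i = ∑ i ∈ T.map Fin.valEmbedding, f i := by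
  rw [Finset.sum_map]
  rfl

/-- The condition for maxmin strategies in terms of sets of natural numbers. -/
theorem isPureMaxmin_iff_range (L : ℕ) (G : Blotto) (u : ℚ≥0) (v : ℝ) (x : G.Pure G.n) (o : ℕ → ℕ)
    (ho : ∀ i : Fin G.k, o i = x.1 i) :
    G.IsPureMaxmin v x ↔ ∀ T ⊆ Finset.range G.k,
      ((∑ i ∈ T, (G.scaled L u).w i : ℕ) : ℝ) < v →
        ∑ i ∈ T, o i + G.m < ∑ i ∈ Finset.range G.k, o i := by
  have hw (T : Finset (Fin G.k)) :
      ∑ i ∈ T, G.w i = ∑ i ∈ T.map Fin.valEmbedding, (G.scaled L u).w i := by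
    rw [← sum_fin_eq_sum_map]
    exact Finset.sum_congr rfl fun i _ => (G.input_arr_zero u i).symm
  have hx (T : Finset (Fin G.k)) :
      ∑ i ∈ T, x.1 i = ∑ i ∈ T.map Fin.valEmbedding, o i := by
    rw [← sum_fin_eq_sum_map]
    exact Finset.sum_congr rfl fun i _ => (ho i).symm
  rw [isPureMaxmin_iff_forall_finset]
  simp only [hw, hx, Fin.map_valEmbedding_univ, Nat.Iio_eq_range]
  constructor
  · intro h T hT
    have hT' : T = (Finset.univ.filter fun i : Fin G.k => (i : ℕ) ∈ T).map Fin.valEmbedding := by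
      ext a
      simp only [Finset.mem_map, Finset.mem_filter, Finset.mem_univ, true_and,
        Fin.valEmbedding_apply]
      constructor
      · intro ha
        exact ⟨⟨a, Finset.mem_range.1 (hT ha)⟩, ha, rfl⟩
      · rintro ⟨i, hi, rfl⟩
        exact hi
    rw [hT']
    exact h _
  · intro h T
    refine h _ fun a ha => ?_
    obtain ⟨i, -, rfl⟩ := Finset.mem_map.1 ha
    exact Finset.mem_range.2 i.2

end Blotto

namespace Scaled

/-- A polynomial in the length of the input that bounds the running time. -/
theorem exists_polynomial (L C : ℕ) : ∃ q : Polynomial ℕ, ∀ (P : Scaled L) (N : ℕ),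
    P.k ≤ N → P.n ≤ N →
    timeBound (C * (N + (P.k + 1) * P.numState + P.numGuess + P.n + 2 + 1)) P.k P.n P.numState
      P.numGuess ≤ q.eval N := by
  have hpoly : ∃ q : Polynomial ℕ, ∀ N : ℕ, q.eval N =
      timeBound (C * (N + (N + 1) * ((N + N * L + 2) * (N + 1)) ^ (2 * numCap L + 1) +
        (N + N * L + 2) ^ (2 * numCap L) + N + 2 + 1)) N N
        (((N + N * L + 2) * (N + 1)) ^ (2 * numCap L + 1)) ((N + N * L + 2) ^ (2 * numCap L)) := by
    let B : Polynomial ℕ := .X + .X * .C L + 2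
    let S : Polynomial ℕ := (B * (.X + 1)) ^ (2 * numCap L + 1)
    let G : Polynomial ℕ := B ^ (2 * numCap L)
    let τ : Polynomial ℕ := .C C * (.X + (.X + 1) * S + G + .X + 2 + 1)
    refine ⟨τ + 1 + (G * (τ + 1 + (τ + 1 + ((.X + 1) * S * (τ + 1 + (.X + 4) * (5 * τ + 4)) +
      (τ + 1)) + (τ + 1 + (τ + 1 + (τ + 1 + (.X * (τ + 1 + (5 * τ + 4)) + (τ + 1)))) +
      (τ + 1)))) + (τ + 1)), fun N => ?_⟩
    simp [timeBound, B, S, G, τ]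
  obtain ⟨q, hq⟩ := hpoly
  refine ⟨q, fun P N hk hn => ?_⟩
  rw [hq]
  unfold timeBound numGuess numState stateBase priceBase
  gcongr

end Scaled

theorem mainTheorem5 (ε : ℝ) (hε : 0 < ε) :
    ∃ (P : RAM.Prog) (q : Polynomial ℕ), ∀ (G : Blotto) (u : ℚ≥0),
      ∃ (s : RAM.State) (t : ℕ), RAM.Exec P (G.input u) s t ∧ t ≤ q.eval (G.inputSize u) ∧
        ((∃ x : G.Pure G.n, G.IsPureMaxmin (u : ℝ) x) →
          ∃ x : G.Pure G.n, G.IsOutput s x ∧ G.IsPureMaxmin ((1 - ε) * (u : ℝ)) x) := by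
  obtain ⟨L₀, hL₀⟩ := exists_nat_gt (3 / ε)
  -- `L ≥ 3` ensures that `L - 3` is not truncated, and `L ≥ 3 / ε` that the total loss is at most `ε`.
  set L := L₀ + 3
  have hL : 3 ≤ L := by omega
  have hLε : 3 ≤ ε * L := by
    have h1 : (3 : ℝ) < L₀ * ε := (div_lt_iff₀ hε).1 hL₀
    have h2 : (L : ℝ) = L₀ + 3 := by simp [L]
    rw [h2]
    nlinarith
  obtain ⟨q, hq⟩ := Scaled.exists_polynomial L ((Scaled.Code.main L).exprs.map RAM.Expr.bitFactor).sum
  refine ⟨Scaled.Code.main L, q, fun G u => ?_⟩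
  set P := G.scaled L u with hP
  set b := G.inputSize u + (P.k + 1) * P.numState + P.numGuess + P.n + 2
  have hk : P.k ≤ G.inputSize u := G.k_le_inputSize u
  have hn : P.n ≤ G.inputSize u := by
    change G.n ≤ _
    unfold Blotto.inputSize
    omega
  obtain ⟨s, t, hexec, ht, hout⟩ := Scaled.runs_main (P := P) (b := b)
    (fun s hs e he => hs.bits.cost_le he) (by omega) (by omega) (by omega) (by omega)
    (G.holds_input L u (by omega)) (by funext i; simp [Blotto.input])
  refine ⟨s, t, hexec, ht.trans (hq P _ hk hn), fun ⟨x, hx⟩ => ?_⟩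
  have hden : (0 : ℝ) < u.den := by exact_mod_cast u.den_pos
  have hu : (u : ℝ) * u.den = u.num := by exact_mod_cast u.mul_den_eq_num
  have hsum : ∑ i ∈ Finset.range P.k, s.arr 1 i ≤ P.n := by
    rcases hout with ⟨h0, -⟩ | ⟨h, -⟩
    · simp [h0]
    · exact h
  have hsum' : ∑ i : Fin G.k, s.arr 1 i ≤ G.n := by
    rwa [Fin.sum_univ_eq_sum_range (s.arr 1)]
  refine ⟨⟨fun i => s.arr 1 i, hsum'⟩, fun i => rfl, ?_⟩
  rw [Blotto.isPureMaxmin_iff_range L G u _ _ (s.arr 1) fun i => rfl]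
  intro T hT hTw
  -- For `u = 0` there is nothing to prove, as no set has negative weight.
  have hu0 : 0 < P.num := by
    refine Nat.pos_of_ne_zero fun h => ?_
    have h' : u = 0 := by rw [← NNRat.num_div_den u, show u.num = 0 from h]; simp
    rw [h'] at hTw
    simp only [NNRat.cast_zero, mul_zero] at hTw
    exact absurd hTw (not_lt.2 (Nat.cast_nonneg _))
  -- If all guesses fail, no strategy guarantees `u`; otherwise the output is certified.
  rcases hout with ⟨-, hno⟩ | ⟨-, p, r, hcert⟩
  · exfalso
    let o : ℕ → ℕ := fun i => if h : i < G.k then x.1 ⟨i, h⟩ else 0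
    have ho : ∀ i : Fin G.k, o i = x.1 i := fun i => by simp [o]
    have hox : ∑ i ∈ Finset.range P.k, o i ≤ P.n := by
      have h1 := Fin.sum_univ_eq_sum_range o G.k
      simp only [ho] at h1
      exact h1.symm.trans_le x.2
    rw [Blotto.isPureMaxmin_iff_range L G u _ _ o ho] at hx
    obtain ⟨g, hg, hc⟩ := Scaled.exists_choice_ne_zero hL hu0 o hox fun S hS hSw => hx S hS (by
      refine lt_of_mul_lt_mul_right ?_ hden.le
      rw [hu]
      exact_mod_cast hSw)
    exact hc (hno g hg)
  · refine hcert.sound hu0 T hT ?_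
    have h1 := mul_le_mul_of_nonneg_right hTw.le hden.le
    rw [mul_assoc, hu] at h1
    have hnum : (0 : ℝ) < u.num := by exact_mod_cast hu0
    have h2 : (((L * (∑ i ∈ T, P.w i) * P.den : ℕ) : ℕ) : ℝ) ≤ (((L - 3) * P.num : ℕ) : ℝ) := by
      rw [Nat.cast_mul, Nat.cast_mul, Nat.cast_mul, Nat.cast_sub hL]
      calc (L : ℝ) * ((∑ i ∈ T, P.w i : ℕ) : ℝ) * (P.den : ℝ)
          = L * (((∑ i ∈ T, P.w i : ℕ) : ℝ) * u.den) := mul_assoc _ _ _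
        _ ≤ L * ((1 - ε) * u.num) := mul_le_mul_of_nonneg_left h1 (Nat.cast_nonneg _)
        _ = (L - ε * L) * u.num := by ring
        _ ≤ (L - (3 : ℕ)) * u.num := by
          refine mul_le_mul_of_nonneg_right ?_ hnum.le
          push_cast
          linarith
    exact_mod_cast h2
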